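/- Conventions. An operator system is a complex $*$-vector space with a compatible family of proper matrix cones and an Archimedean matrix order unit $1$; C*-algebras, $*$-homomorphisms and representations are unital. A C*-cover of an operator system $\mathcal S$ is a pair $(\mathcal C,\rho)$ consisting of a C*-algebra $\mathcal C$ and a unital complete order embedding $\rho:\mathcal S\to\mathcal C$ with $C^*(\rho(\mathcal S))=\mathcal C$. The C*-envelope $(C^*_{\mathrm{env}}(\mathcal S),\iota)$ is the C*-cover such that for every C*-cover $(\mathcal C,\rho)$ there is a unique surjective $*$-homomorphism $\pi:\mathcal C\to C^*_{\mathrm{env}}(\mathcal S)$ with $\pi\circ\rho=\iota$. The operator system $\mathcal S$, embedded in a C*-algebra $\mathcal C$, is hyperrigid in $\mathcal C$ if for every $*$-representation $\pi:\mathcal C\to B(\mathcal H)$ the only unital completely positive map $\mathcal C\to B(\mathcal H)$ that agrees with $\pi$ on $\mathcal S$ is $\pi$ itself; $\mathcal S$ is called hyperrigid if it is hyperrigid in $C^*_{\mathrm{env}}(\mathcal S)$. A dynamical system $(\mathcal S,G,\mathfrak g,\alpha)$ consists of an operator system $\mathcal S$, a discrete group $G$, a generating set $\mathfrak g$ of $G$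 with $\mathfrak g^{-1}=\mathfrak g$ and $e\in\mathfrak g$, and a homomorphism $\alpha$ from $G$ to the group of unital complete order automorphisms of $\mathcal S$. The action $\alpha$ extends uniquely to an action of $G$ by $*$-automorphisms on $C^*_{\mathrm{env}}(\mathcal S)$, again denoted $\alpha$. The full enveloping crossed product is the operator subsystem $$\mathcal S\rtimes_{\alpha,\mathrm{env}}\mathfrak g:=\operatorname{span}\{\iota(a)u_g : a\in\mathcal S,\ g\in\mathfrak g\}$$ of the full C*-crossed product $C^*_{\mathrm{env}}(\mathcal S)\rtimes_\alpha G$, where $u_g$ ($g\in G$) are the canonical unitaries. Theorem. Let $(\mathcal S,G,\mathfrak g,\alpha)$ be a dynamical system and suppose that $\mathcal S$ is hyperrigid. Then $\mathcal S\rtimes_{\alpha,\mathrm{env}}\mathfrak g$ is hyperrigid. In particular, $C^*_{\mathrm{env}}(\mathcal S\rtimes_{\alpha,\mathrm{env}}\mathfrak g)\cong C^*_{\mathrm{env}}(\mathcal S)\rtimes_\alpha G$ by a $*$-isomorphism that is the identity on $\mathcal S\rtimes_{\alpha,\mathrm{env}}\mathfrak g$; that is, $C^*_{\mathrm{env}}(\mathcal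 S)\rtimes_\alpha G$ with the inclusion is a C*-envelope of $\mathcal S\rtimes_{\alpha,\mathrm{env}}\mathfrak g$, and $\mathcal S\rtimes_{\alpha,\mathrm{env}}\mathfrak g$ is hyperrigid in it. -/

import Mathlib

open scoped Matrix ENNReal

universe u v w

/-- (Abstract) operator systems: a complex *-vector space `S` with a proper cone of positive
elements in the hermitian part of each `M_n(S)`, compatible with compressions `M ↦ X* M X` by scalar
matrices, and with an Archimedean matrix order unit `1`. -/
class OperatorSystem (S : Type u) [AddCommGroup S] [Module ℂ S] [StarAddMonoid S]
    [StarModule ℂ S] [One S] where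
  IsPos : ∀ {n : ℕ}, Matrix (Fin n) (Fin n) S → Prop
  isHermitian : ∀ {n : ℕ} {M : Matrix (Fin n) (Fin n) S}, IsPos M → M.IsHermitian
  zero : ∀ n : ℕ, IsPos (0 : Matrix (Fin n) (Fin n) S)
  add : ∀ {n : ℕ} {M N : Matrix (Fin n) (Fin n) S}, IsPos M → IsPos N → IsPos (M + N)
  compression : ∀ {n m : ℕ} (X : Matrix (Fin n) (Fin m) ℂ) {M : Matrix (Fin n) (Fin n) S},
    IsPos M → IsPos (Matrix.of fun i j => ∑ k, ∑ l, (star (X k i) * X l j) • M k l)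
  proper : ∀ {n : ℕ} {M : Matrix (Fin n) (Fin n) S}, IsPos M → IsPos (-M) → M = 0
  orderUnit : ∀ {n : ℕ} {M : Matrix (Fin n) (Fin n) S}, M.IsHermitian →
    ∃ r : ℝ, 0 < r ∧ IsPos (M + (r : ℂ) • Matrix.diagonal fun _ => (1 : S))
  archimedean : ∀ {n : ℕ} {M : Matrix (Fin n) (Fin n) S},
    (∀ r : ℝ, 0 < r → IsPos (M + (r : ℂ) • Matrix.diagonal fun _ => (1 : S))) → IsPos M

/-- Positivity in the C*-algebra `M_n(B)`. -/
def CStarPos {B : Type u} [CStarAlgebra B] {n : ℕ} (M : Matrix (Fin n) (Fin n) B) : Prop :=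
  ∃ N : Matrix (Fin n) (Fin n) B, M = Nᴴ * N

section
variable {B : Type u} [CStarAlgebra B]

theorem nonneg_iff_exists_star_mul_self {A : Type v} [NonUnitalCStarAlgebra A] [PartialOrder A]
    [StarOrderedRing A] (a : A) : 0 ≤ a ↔ ∃ b, a = star b * b :=
  CStarAlgebra.nonneg_iff_eq_star_mul_self

theorem cstarPos_iff [PartialOrder B] [StarOrderedRing B] {n : ℕ}
    (M : Matrix (Fin n) (Fin n) B) : CStarPos M ↔ 0 ≤ CStarMatrix.ofMatrix M := by
  exact (nonneg_iff_exists_star_mul_self (CStarMatrix.ofMatrix M)).symm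

theorem cstarPos_add {n : ℕ} {M N : Matrix (Fin n) (Fin n) B} (hM : CStarPos M)
    (hN : CStarPos N) : CStarPos (M + N) := by
  let _ := CStarAlgebra.spectralOrder B
  let _ := CStarAlgebra.spectralOrderedRing B
  rw [cstarPos_iff] at *
  exact add_nonneg hM hN

theorem cstarPos_compression {n m : ℕ} (X : Matrix (Fin n) (Fin m) ℂ)
    {M : Matrix (Fin n) (Fin n) B} (hM : CStarPos M) :
    CStarPos (Matrix.of fun i j => ∑ k, ∑ l, (star (X k i) * X l j) • M k l) := by
  obtain ⟨N, rfl⟩ := hM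
  rcases m with _ | m
  · exact ⟨0, Subsingleton.elim _ _⟩
  let Y : Fin n → Matrix (Fin (m + 1)) (Fin (m + 1)) B := fun p =>
    Matrix.of fun q j => if q = 0 then ∑ l, X l j • N p l else 0
  have key : (Matrix.of fun i j => ∑ k, ∑ l, (star (X k i) * X l j) • (Nᴴ * N) k l)
      = ∑ p : Fin n, (Y p)ᴴ * Y p := by
    ext i j
    have hY : ∀ p, ((Y p)ᴴ * Y p) i j = star (∑ l, X l i • N p l) * ∑ l, X l j • N p l := by
      intro p
      rw [Matrix.mul_apply, Finset.sum_eq_single 0] <;> simp +contextual [Y]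
    simp only [Matrix.sum_apply, hY, Matrix.of_apply, Matrix.mul_apply, star_sum,
      Finset.sum_mul_sum, Finset.smul_sum, Matrix.conjTranspose_apply, star_smul,
      smul_mul_smul_comm]
    rw [Finset.sum_comm, Finset.sum_comm (s := Finset.univ (α := Fin n))]
    conv_rhs => rw [Finset.sum_comm]
    refine Finset.sum_congr rfl fun k _ => ?_
    rw [Finset.sum_comm]
  rw [key]
  exact Finset.sum_induction _ CStarPos (fun _ _ => cstarPos_add) ⟨0, by simp⟩
    fun p _ => ⟨_, rfl⟩

theorem cstarPos_proper {n : ℕ} {M : Matrix (Fin n) (Fin n) B} (hM : CStarPos M)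
    (hN : CStarPos (-M)) : M = 0 := by
  let _ := CStarAlgebra.spectralOrder B
  let _ := CStarAlgebra.spectralOrderedRing B
  rw [cstarPos_iff] at *
  have h2 : 0 ≤ -(CStarMatrix.ofMatrix M) := hN
  have h3 : CStarMatrix.ofMatrix M = 0 := le_antisymm (neg_nonneg.mp h2) hM
  exact h3

theorem cstarMatrix_ofMatrix_add_smul [PartialOrder B] [StarOrderedRing B] {n : ℕ}
    (M : Matrix (Fin n) (Fin n) B) (r : ℝ) :
    CStarMatrix.ofMatrix (M + (r : ℂ) • Matrix.diagonal fun _ => (1 : B))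
      = CStarMatrix.ofMatrix M + (r : ℂ) • (1 : CStarMatrix (Fin n) (Fin n) B) := rfl

theorem cstarPos_orderUnit {n : ℕ} {M : Matrix (Fin n) (Fin n) B} (hM : M.IsHermitian) :
    ∃ r : ℝ, 0 < r ∧ CStarPos (M + (r : ℂ) • Matrix.diagonal fun _ => (1 : B)) := by
  let _ := CStarAlgebra.spectralOrder B
  let _ := CStarAlgebra.spectralOrderedRing B
  have hs : IsSelfAdjoint (CStarMatrix.ofMatrix M) := hM
  refine ⟨‖CStarMatrix.ofMatrix M‖ + 1, by positivity, ?_⟩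
  rw [cstarPos_iff]
  have h := hs.neg_algebraMap_norm_le_self
  have h1 : (0 : CStarMatrix (Fin n) (Fin n) B) ≤ algebraMap ℝ _ (1 : ℝ) := by simp
  have h2 := add_nonneg (neg_le_iff_add_nonneg.mp h) h1
  rw [cstarMatrix_ofMatrix_add_smul]
  convert h2 using 1
  rw [Algebra.algebraMap_eq_smul_one, Algebra.algebraMap_eq_smul_one, add_assoc,
    Complex.ofReal_add, add_smul]
  rfl

theorem cstarPos_archimedean {n : ℕ} {M : Matrix (Fin n) (Fin n) B}
    (hM : ∀ r : ℝ, 0 < r → CStarPos (M + (r : ℂ) • Matrix.diagonal fun _ => (1 : B))) :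
    CStarPos M := by
  let _ := CStarAlgebra.spectralOrder B
  let _ := CStarAlgebra.spectralOrderedRing B
  simp only [cstarPos_iff, cstarMatrix_ofMatrix_add_smul] at hM ⊢
  have hc : Filter.Tendsto
      (fun r : ℝ => CStarMatrix.ofMatrix M + (r : ℂ) • (1 : CStarMatrix (Fin n) (Fin n) B))
      (nhdsWithin 0 (Set.Ioi 0)) (nhds (CStarMatrix.ofMatrix M)) := by
    have : Continuous
        (fun r : ℝ => CStarMatrix.ofMatrix M + (r : ℂ) • (1 : CStarMatrix (Fin n) (Fin n) B)) := by
      fun_prop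
    have h0 := this.tendsto 0
    simp only [Complex.ofReal_zero, zero_smul, add_zero] at h0
    exact h0.mono_left nhdsWithin_le_nhds
  exact ge_of_tendsto hc (Filter.eventually_of_mem self_mem_nhdsWithin fun r hr => hM r hr)

end

/-- A unital C*-algebra is an operator system. -/
instance CStarAlgebra.instOperatorSystem (B : Type u) [CStarAlgebra B] : OperatorSystem B where
  IsPos := CStarPos
  isHermitian := by rintro n _ ⟨N, rfl⟩; exact Matrix.isHermitian_conjTranspose_mul_self N
  zero := fun n => ⟨0, by simp⟩
  add := cstarPos_add
  compression := cstarPos_compression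
  proper := cstarPos_proper
  orderUnit := cstarPos_orderUnit
  archimedean := cstarPos_archimedean

/-- An operator subsystem of a unital C*-algebra `B`: a self-adjoint linear subspace containing
the unit of `B`. -/
structure OperatorSubsystem (B : Type u) [CStarAlgebra B] extends Submodule ℂ B where
  one_mem' : (1 : B) ∈ toSubmodule
  star_mem' : ∀ x ∈ toSubmodule, star x ∈ toSubmodule

namespace OperatorSubsystem

variable {B : Type u} [CStarAlgebra B] (T : OperatorSubsystem B)

/-- The underlying type of an operator subsystem. -/
def Carrier : Type u := T.toSubmodule

noncomputable instance instAddCommGroup : AddCommGroup T.Carrier := T.toSubmodule.addCommGroup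

noncomputable instance instModule : Module ℂ T.Carrier := T.toSubmodule.module

instance instOne : One T.Carrier := ⟨⟨1, T.one_mem'⟩⟩

noncomputable instance instStarAddMonoid : StarAddMonoid T.Carrier where
  star x := ⟨star x.1, T.star_mem' _ x.2⟩
  star_involutive x := Subtype.ext (star_star x.1)
  star_add x y := Subtype.ext (star_add x.1 y.1)

instance instStarModule : StarModule ℂ T.Carrier where
  star_smul c x := Subtype.ext (star_smul c x.1)

/-- The inclusion of an operator subsystem in its C*-algebra. -/
noncomputable def incl : T.Carrier →ₗ[ℂ] B := T.toSubmodule.subtype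

theorem incl_injective : Function.Injective T.incl := Subtype.val_injective

theorem incl_one : T.incl 1 = 1 := rfl

theorem incl_star (x : T.Carrier) : T.incl (star x) = star (T.incl x) := rfl

theorem map_incl_unit {n : ℕ} (M : Matrix (Fin n) (Fin n) T.Carrier) (r : ℂ) :
    (M + r • Matrix.diagonal fun _ => (1 : T.Carrier)).map T.incl
      = M.map T.incl + r • Matrix.diagonal fun _ => (1 : B) := by
  ext i j
  by_cases h : i = j
  · subst h; simp [incl_one]
  · simp [h]

/-- An operator subsystem of a C*-algebra `B` inherits its matrix order from `B`. -/
instance instOperatorSystem : OperatorSystem T.Carrier where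
  IsPos M := CStarPos (M.map T.incl)
  isHermitian := by
    rintro n M ⟨N, hN⟩
    ext i j
    have h := congrFun (congrFun (Matrix.isHermitian_conjTranspose_mul_self N) i) j
    rw [← hN] at h
    exact T.incl_injective h
  zero n := ⟨0, by ext; simp⟩
  add := by
    intro n M N hM hN
    have := cstarPos_add hM hN
    rwa [← Matrix.map_add _ (map_add T.incl)] at this
  compression := by
    intro n m X M hM
    convert cstarPos_compression X hM using 1
    ext i j
    simp
  proper := by
    intro n M hM hN
    have h := cstarPos_proper hM (by convert hN using 1; ext; simp)
    ext i j
    apply T.incl_injective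
    simpa using congrFun (congrFun h i) j
  orderUnit := by
    intro n M hM
    have h : (M.map T.incl).IsHermitian := by
      ext i j
      exact congrArg T.incl (congrFun (congrFun hM i) j)
    obtain ⟨r, hr, h⟩ := cstarPos_orderUnit h
    exact ⟨r, hr, by rwa [map_incl_unit]⟩
  archimedean := by
    intro n M hM
    refine cstarPos_archimedean fun r hr => ?_
    rw [← map_incl_unit]
    exact hM r hr

end OperatorSubsystem

section Maps

variable {S : Type u} [AddCommGroup S] [Module ℂ S] [StarAddMonoid S] [StarModule ℂ S] [One S]
  [OperatorSystem S]
variable {T : Type v} [AddCommGroup T] [Module ℂ T] [StarAddMonoid T] [StarModule ℂ T] [One T]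
  [OperatorSystem T]

/-- Unital completely positive maps. -/
structure IsUCP (φ : S →ₗ[ℂ] T) : Prop where
  map_one : φ 1 = 1
  map_pos : ∀ {n : ℕ} (M : Matrix (Fin n) (Fin n) S),
    OperatorSystem.IsPos M → OperatorSystem.IsPos (M.map φ)

/-- Unital complete order embeddings. -/
structure IsCompleteOrderEmbedding (φ : S →ₗ[ℂ] T) : Prop where
  map_one : φ 1 = 1
  map_pos_iff : ∀ {n : ℕ} (M : Matrix (Fin n) (Fin n) S),
    OperatorSystem.IsPos (M.map φ) ↔ OperatorSystem.IsPos M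

theorem OperatorSystem.star_one : star (1 : S) = 1 := by
  obtain ⟨r, hr, h⟩ := OperatorSystem.orderUnit (n := 1)
    (M := (0 : Matrix (Fin 1) (Fin 1) S)) (by simp)
  have h2 := congrFun (congrFun (OperatorSystem.isHermitian h) 0) 0
  simp only [zero_add, Matrix.conjTranspose_apply, Matrix.smul_apply, Matrix.diagonal_apply_eq,
    star_smul, RCLike.star_def, Complex.conj_ofReal] at h2
  exact smul_right_injective S (Complex.ofReal_ne_zero.mpr hr.ne') h2

theorem IsUCP.map_star {φ : S →ₗ[ℂ] T} (hφ : IsUCP φ) (x : S) : φ (star x) = star (φ x) := by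
  have h1 : ∀ y : S, star y = y → star (φ y) = φ y := by
    intro y hy
    obtain ⟨r, -, hr⟩ := OperatorSystem.orderUnit (n := 1)
      (M := Matrix.of fun _ _ => y) (by ext; simp [hy])
    have h2 := congrFun (congrFun (OperatorSystem.isHermitian (hφ.map_pos _ hr)) 0) 0
    simpa [hφ.map_one, OperatorSystem.star_one] using h2
  have h3 := realPart_add_I_smul_imaginaryPart x
  have hr := h1 _ (realPart x).2.star_eq
  have hi := h1 _ (imaginaryPart x).2.star_eq
  rw [← h3]
  simp only [star_add, star_smul, map_add, map_smul, (realPart x).2.star_eq,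
    (imaginaryPart x).2.star_eq, hr, hi]

theorem IsCompleteOrderEmbedding.isUCP {φ : S →ₗ[ℂ] T} (hφ : IsCompleteOrderEmbedding φ) :
    IsUCP φ :=
  ⟨hφ.map_one, fun M hM => (hφ.map_pos_iff M).2 hM⟩

end Maps

section Covers

variable {S : Type u} [AddCommGroup S] [Module ℂ S] [StarAddMonoid S] [StarModule ℂ S] [One S]
  [OperatorSystem S]

/-- `(C, ρ)` is a C*-cover of `S`: `ρ` is a unital complete order embedding and `C = C*(ρ(S))`. -/
structure IsCStarCover {C : Type v} [CStarAlgebra C] (ρ : S →ₗ[ℂ] C) : Prop where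
  embedding : IsCompleteOrderEmbedding ρ
  generates : (StarAlgebra.adjoin ℂ (Set.range ρ)).topologicalClosure = ⊤

/-- `(E, ι)` is a C*-envelope of `S`: it is a C*-cover, and for every C*-cover `(C, ρ)` there is a
unique *-epimorphism `π : C → E` with `π ∘ ρ = ι`. -/
structure IsCStarEnvelope {E : Type u} [CStarAlgebra E] (ι : S →ₗ[ℂ] E) : Prop where
  cover : IsCStarCover ι
  universal : ∀ (C : Type u) [CStarAlgebra C] (ρ : S →ₗ[ℂ] C), IsCStarCover ρ →
    ∃! π : C →⋆ₐ[ℂ] E, Function.Surjective π ∧ ∀ s, π (ρ s) = ι s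

/-- Let `ι : S → C` be an inclusion of `S` in a C*-algebra. A map `φ : S → B(H)` has the unique
extension property relative to `C` if it has exactly one ucp extension to `C`, and this extension
is a *-homomorphism. -/
def HasUniqueExtensionProperty {C : Type v} [CStarAlgebra C] (ι : S →ₗ[ℂ] C) {H : Type w}
    [NormedAddCommGroup H] [InnerProductSpace ℂ H] [CompleteSpace H]
    (φ : S →ₗ[ℂ] (H →L[ℂ] H)) : Prop :=
  ∃ π : C →⋆ₐ[ℂ] (H →L[ℂ] H), (∀ s, π (ι s) = φ s) ∧
    ∀ ψ : C →ₗ[ℂ] (H →L[ℂ] H), IsUCP ψ → (∀ s, ψ (ι s) = φ s) → ∀ c, ψ c = π c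

/-- `S`, included in `C` by `ι`, is hyperrigid in `C`: for every unital *-representation `π` of `C`
on a Hilbert space, the restriction of `π` to `S` has the unique extension property. -/
def IsHyperrigid {C : Type u} [CStarAlgebra C] (ι : S →ₗ[ℂ] C) : Prop :=
  ∀ (H : Type u) [NormedAddCommGroup H] [InnerProductSpace ℂ H] [CompleteSpace H]
    (π : C →⋆ₐ[ℂ] (H →L[ℂ] H)),
    HasUniqueExtensionProperty ι ((π : C →ₗ[ℂ] (H →L[ℂ] H)) ∘ₗ ι)

theorem IsCStarCover.hom_ext {C : Type v} [CStarAlgebra C] {ρ : S →ₗ[ℂ] C} (h : IsCStarCover ρ)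
    {D : Type w} [CStarAlgebra D] {f g : C →⋆ₐ[ℂ] D} (hfg : ∀ s, f (ρ s) = g (ρ s)) : f = g := by
  have hle : (StarAlgebra.adjoin ℂ (Set.range ρ)) ≤ StarAlgHom.equalizer f g := by
    refine StarAlgebra.adjoin_le ?_
    rintro _ ⟨s, rfl⟩
    exact hfg s
  have hcl : IsClosed ((StarAlgHom.equalizer f g : StarSubalgebra ℂ C) : Set C) :=
    isClosed_eq
      (AddMonoidHomClass.continuous_of_bound f 1 (by simpa using NonUnitalStarAlgHom.norm_apply_le f))
      (AddMonoidHomClass.continuous_of_bound g 1 (by simpa using NonUnitalStarAlgHom.norm_apply_le g))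
  have := StarSubalgebra.topologicalClosure_minimal hle hcl
  rw [h.generates] at this
  ext x
  exact this (StarSubalgebra.mem_top : x ∈ (⊤ : StarSubalgebra ℂ C))

end Covers

/-- An operator system dynamical system `(S, G, 𝔤, α)`: a group `G` with a generating set `𝔤` such
that `𝔤⁻¹ = 𝔤` and `e ∈ 𝔤`, and a homomorphism `α` from `G` to the group of unital complete order
automorphisms of `S`. -/
structure OperatorDynamicalSystem (S : Type u) [AddCommGroup S] [Module ℂ S] [StarAddMonoid S]
    [StarModule ℂ S] [One S] [OperatorSystem S] (G : Type v) [Group G] where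
  gens : Set G
  closure_gens : Subgroup.closure gens = ⊤
  inv_mem : ∀ g ∈ gens, g⁻¹ ∈ gens
  one_mem : 1 ∈ gens
  action : G →* (S ≃ₗ[ℂ] S)
  isAut : ∀ g, IsCompleteOrderEmbedding (action g : S →ₗ[ℂ] S)

section Envelope

variable {S : Type u} [AddCommGroup S] [Module ℂ S] [StarAddMonoid S] [StarModule ℂ S] [One S]
  [OperatorSystem S] {G : Type v} [Group G]

/-- `(C, ρ, β)` is an `α`-admissible C*-cover of the dynamical system. -/
structure OperatorDynamicalSystem.IsAdmissible (D : OperatorDynamicalSystem S G) {C : Type w}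
    [CStarAlgebra C] (ρ : S →ₗ[ℂ] C) (β : G →* (C ≃⋆ₐ[ℂ] C)) : Prop where
  cover : IsCStarCover ρ
  equivariant : ∀ g s, β g (ρ s) = ρ (D.action g s)

theorem OperatorDynamicalSystem.isCStarCover_comp (D : OperatorDynamicalSystem S G) {E : Type w}
    [CStarAlgebra E] {ι : S →ₗ[ℂ] E} (hι : IsCStarCover ι) (g : G) :
    IsCStarCover (ι ∘ₗ (D.action g : S →ₗ[ℂ] S)) where
  embedding :=
    { map_one := by
        have := (D.isAut g).map_one
        simp only [LinearEquiv.coe_coe] at this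
        simp [this, hι.embedding.map_one]
      map_pos_iff := fun M => by
        rw [← (D.isAut g).map_pos_iff M, ← hι.embedding.map_pos_iff, Matrix.map_map]
        rfl }
  generates := by
    have : Set.range (ι ∘ₗ (D.action g : S →ₗ[ℂ] S)) = Set.range ι := by
      rw [LinearMap.coe_comp]
      exact (D.action g).surjective.range_comp ι
    rw [this, hι.generates]

/-- The action on `S` extends (uniquely) to an action on the C*-envelope. -/
theorem OperatorDynamicalSystem.exists_envelopeAction (D : OperatorDynamicalSystem S G)
    {E : Type u} [CStarAlgebra E] {ι : S →ₗ[ℂ] E} (hι : IsCStarEnvelope ι) :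
    ∃ β : G →* (E ≃⋆ₐ[ℂ] E), D.IsAdmissible ι β := by
  have h : ∀ g, ∃ π : E →⋆ₐ[ℂ] E, ∀ s, π (ι s) = ι (D.action g s) := by
    intro g
    obtain ⟨π, ⟨-, hπ⟩, -⟩ := hι.universal E _ (D.isCStarCover_comp hι.cover g⁻¹)
    refine ⟨π, fun s => ?_⟩
    have := hπ (D.action g s)
    simpa [← LinearEquiv.mul_apply, ← map_mul] using this
  choose π hπ using h
  have hmul : ∀ g h, π (g * h) = (π g).comp (π h) := fun g h =>
    hι.cover.hom_ext fun s => by simp [hπ]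
  have hone : π 1 = StarAlgHom.id ℂ E := hι.cover.hom_ext fun s => by simp [hπ]
  have hinv : ∀ g, (π g).comp (π g⁻¹) = StarAlgHom.id ℂ E := fun g => by
    rw [← hmul, mul_inv_cancel, hone]
  have hinv' : ∀ g, (π g⁻¹).comp (π g) = StarAlgHom.id ℂ E := fun g => by
    rw [← hmul, inv_mul_cancel, hone]
  refine ⟨
    { toFun := fun g => StarAlgEquiv.ofStarAlgHom (π g) (π g⁻¹) (hinv' g) (hinv g)
      map_one' := ?_
      map_mul' := ?_ }, ⟨hι.cover, fun g s => hπ g s⟩⟩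
  · ext x; exact DFunLike.congr_fun hone x
  · intro g h; ext x; exact DFunLike.congr_fun (hmul g h) x

/-- The action of `G` on the C*-envelope `E` of `S` that extends `α`. -/
noncomputable def OperatorDynamicalSystem.envelopeAction (D : OperatorDynamicalSystem S G)
    {E : Type u} [CStarAlgebra E] {ι : S →ₗ[ℂ] E} (hι : IsCStarEnvelope ι) :
    G →* (E ≃⋆ₐ[ℂ] E) :=
  (D.exists_envelopeAction hι).choose

theorem OperatorDynamicalSystem.isAdmissible_envelopeAction (D : OperatorDynamicalSystem S G)
    {E : Type u} [CStarAlgebra E] {ι : S →ₗ[ℂ] E} (hι : IsCStarEnvelope ι) :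
    D.IsAdmissible ι (D.envelopeAction hι) :=
  (D.exists_envelopeAction hι).choose_spec

end Envelope

section CrossedProduct

variable {E : Type u} [CStarAlgebra E] {G : Type u} [Group G]

/-- A covariant representation `(π, U)` of the C*-dynamical system `(E, G, β)` on a nonzero Hilbert
space `H`. -/
structure CovariantRep (β : G →* (E ≃⋆ₐ[ℂ] E)) : Type (u + 1) where
  H : Type u
  [normed : NormedAddCommGroup H]
  [inner : InnerProductSpace ℂ H]
  [complete : CompleteSpace H]
  [nontrivial : Nontrivial H]
  π : E →⋆ₐ[ℂ] (H →L[ℂ] H)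
  U : G →* unitary (H →L[ℂ] H)
  covariant : ∀ g a, π (β g a) = (U g : H →L[ℂ] H) * π a * star (U g : H →L[ℂ] H)

attribute [instance] CovariantRep.normed CovariantRep.inner CovariantRep.complete
  CovariantRep.nontrivial

namespace CovariantRep

variable {β : G →* (E ≃⋆ₐ[ℂ] E)}

/-- The integrated form `∑ a_g u_g ↦ ∑ π(a_g) U_g` on `C_c(G, E)`. -/
noncomputable def integrated (R : CovariantRep β) (f : G →₀ E) : R.H →L[ℂ] R.H :=
  f.sum fun g a => R.π a * (R.U g : R.H →L[ℂ] R.H)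

/-- The seminorm on `C_c(G, E)` defined by a covariant representation. -/
noncomputable def seminorm (R : CovariantRep β) (f : G →₀ E) : ℝ := ‖R.integrated f‖

end CovariantRep

namespace CrossedProduct

variable (β : G →* (E ≃⋆ₐ[ℂ] E))

/-- The set of all seminorms on `C_c(G, E)` that come from covariant representations. -/
abbrev Index : Type u := Set.range (CovariantRep.seminorm (β := β))

/-- For every such seminorm, a covariant representation that defines it. -/
noncomputable def rep (p : Index β) : CovariantRep β := p.2.choose

theorem seminorm_rep (p : Index β) : (rep β p).seminorm = p := p.2.choose_spec

/-- The `ℓ^∞` direct sum of the algebras `B(H_p)`. -/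
abbrev Ambient : Type u :=
  lp (fun p : Index β => (rep β p).H →L[ℂ] (rep β p).H) ∞

noncomputable instance : CStarAlgebra (Ambient β) where

/-- The direct sum of the representations `π_p` of `E`. -/
noncomputable def ambientRep : E →⋆ₐ[ℂ] Ambient β where
  toFun a := ⟨fun p => (rep β p).π a, memℓp_infty ⟨‖a‖, by
    rintro _ ⟨p, rfl⟩
    exact NonUnitalStarAlgHom.norm_apply_le (rep β p).π a⟩⟩
  map_one' := by ext p : 2; simp
  map_mul' a b := by ext p : 2; simp
  map_zero' := by ext p : 2; simp
  map_add' a b := by ext p : 2; exact map_add (rep β p).π a b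
  commutes' c := by ext p : 2; simp [Algebra.algebraMap_eq_smul_one]
  map_star' a := by ext p : 2; simp [map_star]

/-- The direct sum of the unitaries `U_p g`. -/
noncomputable def ambientUnitary (g : G) : Ambient β :=
  ⟨fun p => ((rep β p).U g : _ →L[ℂ] _), memℓp_infty ⟨1, by
    rintro _ ⟨p, rfl⟩
    exact (CStarRing.norm_coe_unitary _).le⟩⟩

/-- The projection to the `p`-th summand. -/
noncomputable def ambientEval (p : Index β) :
    Ambient β →⋆ₐ[ℂ] ((rep β p).H →L[ℂ] (rep β p).H) where
  toFun x := x p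
  map_one' := rfl
  map_mul' _ _ := rfl
  map_zero' := rfl
  map_add' _ _ := rfl
  commutes' _ := rfl
  map_star' _ := rfl

/-- The closed *-subalgebra of `∏ B(H_p)` generated by the copies of `E` and `G`. -/
noncomputable def subalgebra : StarSubalgebra ℂ (Ambient β) :=
  (StarAlgebra.adjoin ℂ
    (Set.range (ambientRep β) ∪ Set.range (ambientUnitary β))).topologicalClosure

end CrossedProduct

/-- The full crossed product C*-algebra `E ⋊_β G`, realized in the direct sum of covariant
representations that together induce every seminorm which a covariant representation induces on
`C_c(G, E)`. It is the completion of `C_c(G, E)` in the universal norm; see `seminorm_le_norm` and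
`norm_le_of_seminorm_le` below. (Choosing one representation for each seminorm keeps the family of
representations small.) -/
def CrossedProduct (β : G →* (E ≃⋆ₐ[ℂ] E)) : Type u := CrossedProduct.subalgebra β

namespace CrossedProduct

variable (β : G →* (E ≃⋆ₐ[ℂ] E))

noncomputable instance instCStarAlgebra : CStarAlgebra (CrossedProduct β) :=
  StarSubalgebra.cstarAlgebra (CrossedProduct.subalgebra β)
    (h_closed := StarSubalgebra.isClosed_topologicalClosure _)

/-- The canonical *-homomorphism `E → E ⋊_β G`. -/
noncomputable def ofAlg : E →⋆ₐ[ℂ] CrossedProduct β :=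
  (ambientRep β).codRestrict (subalgebra β) fun a =>
    StarSubalgebra.le_topologicalClosure _
      (StarAlgebra.subset_adjoin ℂ _ (Or.inl ⟨a, rfl⟩))

/-- The canonical element `u_g` of `E ⋊_β G`. -/
noncomputable def u (g : G) : CrossedProduct β :=
  ⟨ambientUnitary β g, StarSubalgebra.le_topologicalClosure _
    (StarAlgebra.subset_adjoin ℂ _ (Or.inr ⟨g, rfl⟩))⟩

/-- The representation of `E ⋊_β G` on `H_p`. -/
noncomputable def eval (p : Index β) :
    CrossedProduct β →⋆ₐ[ℂ] ((rep β p).H →L[ℂ] (rep β p).H) :=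
  (ambientEval β p).comp (subalgebra β).subtype

theorem eval_ext {x y : CrossedProduct β} (h : ∀ p, eval β p x = eval β p y) : x = y :=
  Subtype.ext (lp.ext (funext h))

theorem eval_ofAlg (p : Index β) (a : E) : eval β p (ofAlg β a) = (rep β p).π a := rfl

theorem eval_u (p : Index β) (g : G) : eval β p (u β g) = ((rep β p).U g).1 := rfl

theorem u_one : u β 1 = 1 := eval_ext β fun p => by
  rw [eval_u, map_one, map_one, OneMemClass.coe_one]

theorem u_mul (g h : G) : u β (g * h) = u β g * u β h := eval_ext β fun p => by
  rw [map_mul, eval_u, eval_u, eval_u, map_mul, Submonoid.coe_mul]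

theorem star_u (g : G) : star (u β g) = u β g⁻¹ := eval_ext β fun p => by
  rw [map_star, eval_u, eval_u, map_inv]
  rfl

theorem covariant (g : G) (a : E) : ofAlg β (β g a) = u β g * ofAlg β a * star (u β g) :=
  eval_ext β fun p => by
    rw [map_mul, map_mul, map_star, eval_ofAlg, eval_ofAlg, eval_u]
    exact (rep β p).covariant g a

/-- The canonical map `C_c(G, E) → E ⋊_β G`. -/
noncomputable def ofFinsupp (f : G →₀ E) : CrossedProduct β :=
  f.sum fun g a => ofAlg β a * u β g

theorem eval_ofFinsupp (f : G →₀ E) (p : Index β) :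
    eval β p (ofFinsupp β f) = (rep β p).integrated f := by
  rw [ofFinsupp, CovariantRep.integrated, Finsupp.sum, Finsupp.sum, map_sum]
  exact Finset.sum_congr rfl fun g _ => by rw [map_mul, eval_ofAlg, eval_u]

/-- The norm of `E ⋊_β G` is the universal norm on `C_c(G, E)`: the least upper bound of the
seminorms defined by covariant representations. -/
theorem seminorm_le_norm (R : CovariantRep β) (f : G →₀ E) : R.seminorm f ≤ ‖ofFinsupp β f‖ := by
  have h : ‖eval β ⟨R.seminorm, R, rfl⟩ (ofFinsupp β f)‖ ≤ ‖ofFinsupp β f‖ :=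
    NonUnitalStarAlgHom.norm_apply_le _ _
  rw [eval_ofFinsupp] at h
  exact (congrFun (seminorm_rep β ⟨R.seminorm, R, rfl⟩) f).symm.le.trans h

theorem norm_le_of_seminorm_le (f : G →₀ E) {c : ℝ} (hc : 0 ≤ c)
    (h : ∀ R : CovariantRep β, R.seminorm f ≤ c) : ‖ofFinsupp β f‖ ≤ c := by
  refine lp.norm_le_of_forall_le hc fun p => ?_
  change ‖eval β p (ofFinsupp β f)‖ ≤ c
  rw [eval_ofFinsupp]
  exact h (rep β p)

end CrossedProduct

end CrossedProduct

section FullCrossedProduct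

variable {S : Type u} [AddCommGroup S] [Module ℂ S] [StarAddMonoid S] [StarModule ℂ S] [One S]
  [OperatorSystem S] {G : Type u} [Group G]

/-- The full crossed product `S ⋊_α^C 𝔤` relative to an `α`-admissible C*-cover `(C, ρ, β)`: the
operator subsystem `span {ρ(a) u_g : a ∈ S, g ∈ 𝔤}` of `C ⋊_β G`. -/
noncomputable def OperatorDynamicalSystem.relFullCrossedProduct
    (D : OperatorDynamicalSystem S G) {C : Type u} [CStarAlgebra C] {ρ : S →ₗ[ℂ] C}
    {β : G →* (C ≃⋆ₐ[ℂ] C)} (h : D.IsAdmissible ρ β) : OperatorSubsystem (CrossedProduct β) where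
  toSubmodule := Submodule.span ℂ
    {x | ∃ a : S, ∃ g ∈ D.gens, x = CrossedProduct.ofAlg β (ρ a) * CrossedProduct.u β g}
  one_mem' := Submodule.subset_span ⟨1, 1, D.one_mem, by
    rw [h.cover.embedding.map_one, map_one, CrossedProduct.u_one, one_mul]⟩
  star_mem' x hx := by
    induction hx using Submodule.span_induction with
    | mem x hx =>
      obtain ⟨a, g, hg, rfl⟩ := hx
      refine Submodule.subset_span ⟨D.action g⁻¹ (star a), g⁻¹, D.inv_mem g hg, ?_⟩
      rw [← h.equivariant, CrossedProduct.covariant, star_mul, CrossedProduct.star_u,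
        CrossedProduct.star_u, inv_inv, mul_assoc, ← CrossedProduct.u_mul, mul_inv_cancel,
        CrossedProduct.u_one, mul_one, h.cover.embedding.isUCP.map_star, map_star]
    | zero => simp
    | add x y _ _ hx hy => rw [star_add]; exact Submodule.add_mem _ hx hy
    | smul c x _ hx => rw [star_smul]; exact Submodule.smul_mem _ _ hx

/-- The full enveloping crossed product `S ⋊_{α,env} 𝔤 ⊆ C*_env(S) ⋊_α G`. -/
noncomputable def OperatorDynamicalSystem.fullEnvelopingCrossedProduct
    (D : OperatorDynamicalSystem S G) {E : Type u} [CStarAlgebra E] {ι : S →ₗ[ℂ] E}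
    (hι : IsCStarEnvelope ι) : OperatorSubsystem (CrossedProduct (D.envelopeAction hι)) :=
  D.relFullCrossedProduct (D.isAdmissible_envelopeAction hι)

end FullCrossedProduct

/-! ### Positive operator matrices, compressions by isometries and invariance. -/

section HilbertSpace

open ContinuousLinearMap

variable {H : Type u} [NormedAddCommGroup H] [InnerProductSpace ℂ H] [CompleteSpace H]
variable {K : Type v} [NormedAddCommGroup K] [InnerProductSpace ℂ K] [CompleteSpace K]

/-! Let `π` be a representation of the crossed product of the envelope `E` by `G`, and let `ψ` be a
ucp map that agrees with it on the subsystem. Dilate `ψ` to a representation `σ`, so that `ψ = V* σ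
V` with an isometry `V`. On the copy of `E`, `ψ` is a ucp extension of `π` restricted to `S`, so
hyperrigidity of `S` forces `ψ = π` there. For a generator `g`, `ψ(u_g) = π(u_g)` is unitary. In
both cases the compression has the correct value on `X* X` as well as on `X`, and a norm computation
(`apply_isometry_eq_of_compression`) gives `σ(X) V = V π(X)`. So `V H` is invariant under a
self-adjoint generating set, `ψ` is a *-homomorphism, and it equals `π` because the two agree on
generators (`isHyperrigid_relFullCrossedProduct`).

That the crossed product is the envelope is a general fact about a hyperrigid generating subsystem
`T` of `A`. Given another cover `C`, dilate `π|T` to a representation `σ` of `C`, and `σ|T` to a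
representation `τ` of `A`. By hyperrigidity `τ` compresses to `π`, hence `H` is invariant under
`τ(T)`, and therefore under `σ(T)`; thus `π|T` extends to a representation of `C`
(`exists_starAlgHom_cover`). Applied to each member of a faithful family of representations of `A`,
this gives the map from `C` onto `A` (`IsHyperrigid.isCStarEnvelope`).

Both halves rest on `IsUCP.exists_dilation`, which obtains the theorems of Arveson and Stinespring
together: extend one scalar functional by M. Riesz's theorem, then apply a GNS construction. -/

/-- The quadratic form of a positive matrix of operators is nonnegative. -/
theorem CStarPos.re_sum_inner_nonneg {n : ℕ} {M : Matrix (Fin n) (Fin n) (H →L[ℂ] H)}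
    (hM : CStarPos M) (x : Fin n → H) : 0 ≤ (∑ i, ∑ j, inner ℂ (x i) (M i j (x j))).re := by
  obtain ⟨N, rfl⟩ := hM
  have h : ∑ i, ∑ j, inner ℂ (x i) ((Nᴴ * N) i j (x j))
      = ∑ k, inner ℂ (∑ i, N k i (x i)) (∑ j, N k j (x j)) := by
    simp only [Matrix.mul_apply, Matrix.conjTranspose_apply, sum_inner, inner_sum,
      sum_apply, star_eq_adjoint, mul_apply_eq_comp, adjoint_inner_right]
    rw [Finset.sum_comm]
    refine (Finset.sum_congr rfl fun j _ => Finset.sum_comm).trans ?_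
    rw [Finset.sum_comm]
  rw [h, Complex.re_sum]
  exact Finset.sum_nonneg fun k _ => inner_self_nonneg (𝕜 := ℂ)

/-- The Gram matrix `(Tᵢ* Tⱼ)` of a family of operators is positive. -/
theorem cstarPos_adjoint_comp {n : ℕ} (T : Fin n → H →L[ℂ] K) :
    CStarPos (Matrix.of fun i j => adjoint (T i) ∘L T j) := by
  -- The `Tᵢ` land in `K`, but `CStarPos` wants a factor with entries in `B(H)`. The row operator `R
  -- : Hⁿ → K` is therefore replaced by `Q` on `Hⁿ` with `Q* Q = R* R`, and the blocks of `Q` are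
  -- the witness.
  let L := PiLp 2 fun _ : Fin n => H
  let p : Fin n → L →L[ℂ] H := fun i => PiLp.proj 2 (fun _ : Fin n => H) i
  let R : L →L[ℂ] K := ∑ i, T i ∘L p i
  have hpa : ∀ i z, p i z = z i := fun _ _ => rfl
  have hp : ∀ j x, adjoint (p j) x = WithLp.toLp 2 (Pi.single j x) := by
    intro j x
    refine ext_inner_left ℂ fun z => ?_
    rw [adjoint_inner_right, PiLp.inner_apply, Finset.sum_eq_single j]
    · simp [hpa]
    · intro b _ hb
      simp [hb]
    · simp
  have hR : ∀ j x, R (adjoint (p j) x) = T j x := by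
    intro j x
    rw [hp, sum_apply, Finset.sum_eq_single j]
    · simp [hpa]
    · intro b _ hb
      simp [hpa, hb]
    · simp
  have hpos : 0 ≤ adjoint R ∘L R := (nonneg_iff_isPositive _).2 (isPositive_adjoint_comp_self R)
  obtain ⟨Q, hQ⟩ := (nonneg_iff_exists_star_mul_self (adjoint R ∘L R)).1 hpos
  have hRQ : ∀ y x, inner ℂ (Q y) (Q x) = inner ℂ (R y) (R x) := by
    intro y x
    have := congrArg (fun A : L →L[ℂ] L => inner ℂ y (A x)) hQ
    simpa [star_eq_adjoint, adjoint_inner_right] using this.symm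
  refine ⟨Matrix.of fun k j => p k ∘L Q ∘L adjoint (p j), ?_⟩
  ext i j x
  refine ext_inner_left ℂ fun y => ?_
  have h := hRQ (adjoint (p i) y) (adjoint (p j) x)
  rw [hR, hR, PiLp.inner_apply] at h
  simp only [Matrix.of_apply, comp_apply, adjoint_inner_right, Matrix.mul_apply,
    Matrix.conjTranspose_apply, sum_apply, star_eq_adjoint, mul_apply_eq_comp, inner_sum]
  exact h.symm

/-- The compression of a *-representation by an isometry, as a linear map. -/
noncomputable def compression {C : Type w} [CStarAlgebra C] (σ : C →⋆ₐ[ℂ] (K →L[ℂ] K))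
    (V : H →ₗᵢ[ℂ] K) : C →ₗ[ℂ] (H →L[ℂ] H) where
  toFun c := adjoint V.toContinuousLinearMap ∘L σ c ∘L V.toContinuousLinearMap
  map_add' a b := by ext; simp
  map_smul' a b := by ext; simp

theorem compression_apply {C : Type w} [CStarAlgebra C] (σ : C →⋆ₐ[ℂ] (K →L[ℂ] K))
    (V : H →ₗᵢ[ℂ] K) (c : C) : compression σ V c =
      adjoint V.toContinuousLinearMap ∘L σ c ∘L V.toContinuousLinearMap := rfl

/-- The compression of a *-representation by an isometry is unital completely positive. -/
theorem isUCP_compression {C : Type w} [CStarAlgebra C] (σ : C →⋆ₐ[ℂ] (K →L[ℂ] K))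
    (V : H →ₗᵢ[ℂ] K) : IsUCP (compression σ V) where
  map_one := by
    rw [compression_apply, map_one]
    exact V.adjoint_comp_self
  map_pos := by
    rintro n _ ⟨N, rfl⟩
    have h : (Nᴴ * N).map (compression σ V) = ∑ k, Matrix.of fun i j =>
        adjoint (σ (N k i) ∘L V.toContinuousLinearMap) ∘L (σ (N k j) ∘L V.toContinuousLinearMap) := by
      ext i j x
      simp only [Matrix.map_apply, Matrix.mul_apply, Matrix.conjTranspose_apply, map_sum,
        Matrix.sum_apply, Matrix.of_apply, adjoint_comp, compression_apply, map_mul, map_star,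
        star_eq_adjoint]
      simp
    rw [h]
    exact Finset.sum_induction _ CStarPos (fun _ _ => cstarPos_add) ⟨0, by simp⟩
      fun k _ => cstarPos_adjoint_comp _

theorem isUCP_starAlgHom {B : Type u} {C : Type v} [CStarAlgebra B] [CStarAlgebra C]
    (π : B →⋆ₐ[ℂ] C) : IsUCP (π : B →ₗ[ℂ] C) where
  map_one := map_one π
  map_pos := by
    rintro n _ ⟨N, rfl⟩
    refine ⟨N.map π, ?_⟩
    ext i j
    simp [Matrix.mul_apply, map_star]

/-- If the compression of `X` to an isometric copy of `H` is `Y`, and that of `X* X` is `Y* Y`,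
then `X` leaves the copy of `H` invariant. -/
theorem apply_isometry_eq_of_compression (V : H →ₗᵢ[ℂ] K) {X : K →L[ℂ] K} {Y : H →L[ℂ] H}
    (hX : adjoint V.toContinuousLinearMap ∘L X ∘L V.toContinuousLinearMap = Y)
    (hXX : adjoint V.toContinuousLinearMap ∘L (star X * X) ∘L V.toContinuousLinearMap
      = star Y * Y) (x : H) : X (V x) = V (Y x) := by
  have h1 : inner ℂ (X (V x)) (X (V x)) = inner ℂ (Y x) (Y x) := by
    have := congrArg (fun A : H →L[ℂ] H => inner ℂ x (A x)) hXX
    simpa [star_eq_adjoint, adjoint_inner_right] using this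
  have h2 : inner ℂ (V (Y x)) (X (V x)) = inner ℂ (Y x) (Y x) := by
    have := congrArg (fun A : H →L[ℂ] H => inner ℂ (Y x) (A x)) hX
    simpa [adjoint_inner_right] using this
  have h3 : inner ℂ (X (V x)) (V (Y x)) = inner ℂ (Y x) (Y x) := by
    rw [← inner_conj_symm, h2, inner_conj_symm]
  -- The four terms of `‖X V x - V Y x‖²` are all `±‖Y x‖²`, and they cancel.
  rw [← sub_eq_zero, ← inner_self_eq_zero (𝕜 := ℂ), inner_sub_left, inner_sub_right,
    inner_sub_right, h1, h2, h3, V.inner_map_map]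
  ring

/-- If an isometric copy of `H` is invariant under a self-adjoint generating set of `C`, then the
compression to it is a *-homomorphism. -/
theorem exists_starAlgHom_eq_compression {C : Type w} [CStarAlgebra C]
    (σ : C →⋆ₐ[ℂ] (K →L[ℂ] K)) (V : H →ₗᵢ[ℂ] K) {s : Set C}
    (hs : (StarAlgebra.adjoin ℂ s).topologicalClosure = ⊤) (hstar : ∀ c ∈ s, star c ∈ s)
    (hinv : ∀ c ∈ s, ∀ x, ∃ y, σ c (V x) = V y) :
    ∃ π : C →⋆ₐ[ℂ] (H →L[ℂ] H), ∀ c, π c = compression σ V c := by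
  have hσ : Continuous σ :=
    AddMonoidHomClass.continuous_of_bound σ 1 (by simpa using NonUnitalStarAlgHom.norm_apply_le σ)
  have hVV : ∀ x, adjoint V.toContinuousLinearMap (V x) = x := fun x =>
    congrArg (fun A : H →L[ℂ] H => A x) V.adjoint_comp_self
  -- This says that `σ c` maps the range of `V` into itself.
  have key : ∀ c x, V (compression σ V c x) = σ c (V x) := by
    let I : Set C := {c | ∀ x, V (compression σ V c x) = σ c (V x)}
    have hI : IsClosed I := by
      have : I = ⋂ x, {c | V (compression σ V c x) = σ c (V x)} := by ext; simp [I]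
      rw [this]
      refine isClosed_iInter fun x => isClosed_eq ?_ ?_
      · simp only [compression_apply, comp_apply]
        fun_prop
      · fun_prop
    -- Invariance under `σ c` alone does not pass to `star c`, so the induction carries both.
    have hadj : ∀ c ∈ StarAlgebra.adjoin ℂ s, c ∈ I ∧ star c ∈ I := by
      intro c hc
      induction hc using StarAlgebra.adjoin_induction with
      | mem c hc =>
        have : ∀ c ∈ s, c ∈ I := by
          intro c hc x
          obtain ⟨y, hy⟩ := hinv c hc x
          rw [compression_apply, comp_apply, comp_apply, LinearIsometry.coe_toContinuousLinearMap,
            hy, hVV]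
        exact ⟨this c hc, this _ (hstar c hc)⟩
      | algebraMap r =>
        have : ∀ r : ℂ, algebraMap ℂ C r ∈ I := by
          intro r x
          simp [compression_apply, Algebra.algebraMap_eq_smul_one, hVV]
        refine ⟨this r, ?_⟩
        rw [← algebraMap_star_comm]
        exact this _
      | add a b _ _ ha hb =>
        have : ∀ a b, a ∈ I → b ∈ I → a + b ∈ I := by
          intro a b ha hb x
          simp [ha x, hb x]
        rw [star_add]
        exact ⟨this _ _ ha.1 hb.1, this _ _ ha.2 hb.2⟩
      | mul a b _ _ ha hb =>
        have : ∀ a b, a ∈ I → b ∈ I → a * b ∈ I := by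
          intro a b ha hb x
          have h1 : compression σ V (a * b) x = compression σ V a (compression σ V b x) := by
            conv_rhs => rw [compression_apply]
            simp only [comp_apply, LinearIsometry.coe_toContinuousLinearMap, hb x]
            simp [compression_apply]
          rw [h1, ha, hb, map_mul, mul_apply_eq_comp]
        rw [star_mul]
        exact ⟨this _ _ ha.1 hb.1, this _ _ hb.2 ha.2⟩
      | star a _ ha => exact ⟨ha.2, by rw [star_star]; exact ha.1⟩
    intro c
    have hc : c ∈ (StarAlgebra.adjoin ℂ s).topologicalClosure := by
      rw [hs]; exact StarSubalgebra.mem_top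
    exact closure_minimal (fun c hc => (hadj c hc).1) hI hc
  refine ⟨
    { toFun := compression σ V
      map_one' := (isUCP_compression σ V).map_one
      map_mul' := fun a b => ?_
      map_zero' := map_zero _
      map_add' := map_add _
      commutes' := fun r => ?_
      map_star' := (isUCP_compression σ V).map_star }, fun c => rfl⟩
  · ext x
    apply V.injective
    rw [key, mul_apply_eq_comp, key, key, map_mul, mul_apply_eq_comp]
  · rw [Algebra.algebraMap_eq_smul_one, map_smul, (isUCP_compression σ V).map_one,
      Algebra.algebraMap_eq_smul_one]

end HilbertSpace

/-! ### Representations on completions of pre-inner product spaces. -/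

section GNS

open UniformSpace Completion ContinuousLinearMap

/-- A representation of a C*-algebra by adjointable linear operators on a pre-inner product space
extends to the completion. -/
theorem exists_starAlgHom_of_preInnerProductSpace {C : Type v} [CStarAlgebra C] {X : Type u}
    [AddCommGroup X] [Module ℂ X] (core : PreInnerProductSpace.Core ℂ X)
    (L : C →ₐ[ℂ] Module.End ℂ X)
    (hL : ∀ c x y, core.inner (L c x) y = core.inner x (L (star c) y)) :
    ∃ (K : Type u) (_ : NormedAddCommGroup K) (_ : InnerProductSpace ℂ K) (_ : CompleteSpace K)
      (σ : C →⋆ₐ[ℂ] (K →L[ℂ] K)) (j : X →ₗ[ℂ] K),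
      (∀ x y, inner ℂ (j x) (j y) = core.inner x y) ∧ ∀ c x, σ c (j x) = j (L c x) := by
  let _ : SeminormedAddCommGroup X :=
    InnerProductSpace.Core.toSeminormedAddCommGroup (c := core)
  let _ : InnerProductSpace ℂ X := InnerProductSpace.ofCore core
  have hL' : ∀ c (x y : X), inner ℂ (L c x) y = inner ℂ x (L (star c) y) := hL
  have hbound : ∀ c x, ‖L c x‖ ≤ ‖c‖ * ‖x‖ := by
    intro c x
    let _ := CStarAlgebra.spectralOrder C
    let _ := CStarAlgebra.spectralOrderedRing C
    -- With `‖c‖² - c* c = d* d`, the difference `‖c‖² ‖x‖² - ‖c x‖²` equals `‖d x‖²`; this bounds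
    -- the action of `c`.
    have hd : 0 ≤ algebraMap ℝ C (‖c‖ ^ 2) - star c * c := by
      rw [sub_nonneg, sq, ← CStarRing.norm_star_mul_self (x := c)]
      exact (IsSelfAdjoint.star_mul_self c).le_algebraMap_norm_self
    obtain ⟨d, hd⟩ := (nonneg_iff_exists_star_mul_self _).1 hd
    have h1 : inner ℂ (L d x) (L d x) = (‖c‖ ^ 2 : ℝ) * inner ℂ x x - inner ℂ (L c x) (L c x) := by
      have h2 : star d * d = ((‖c‖ ^ 2 : ℝ) : ℂ) • 1 - star c * c := by
        rw [← hd, Algebra.algebraMap_eq_smul_one, Complex.coe_smul]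
      rw [hL', hL', ← Module.End.mul_apply, ← Module.End.mul_apply, ← map_mul, ← map_mul, h2,
        map_sub, map_smul, map_one, LinearMap.sub_apply, inner_sub_right, LinearMap.smul_apply,
        inner_smul_right, Module.End.one_apply]
    have h3 : 0 ≤ (inner ℂ (L d x) (L d x)).re := inner_self_nonneg (𝕜 := ℂ)
    have h4 : ∀ y : X, (inner ℂ y y).re = ‖y‖ ^ 2 := inner_self_eq_norm_sq (𝕜 := ℂ)
    rw [h1, Complex.sub_re, Complex.re_ofReal_mul, h4, h4, sub_nonneg, ← mul_pow] at h3
    exact le_of_sq_le_sq h3 (by positivity)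
  let A : C → X →L[ℂ] X := fun c => (L c).mkContinuous ‖c‖ (hbound c)
  have hA : ∀ c x, A c x = L c x := fun _ _ => rfl
  -- The completion is Hausdorff, so null vectors vanish in it and no separate quotient is needed.
  refine ⟨Completion X, inferInstance, inferInstance, inferInstance,
    { toFun := fun c => (A c).completion
      map_one' := ?_
      map_mul' := ?_
      map_zero' := ?_
      map_add' := ?_
      commutes' := ?_
      map_star' := ?_ }, (toComplL : X →L[ℂ] Completion X), ?_, ?_⟩
  · ext x
    induction x using induction_on with
    | hp => apply isClosed_eq <;> fun_prop
    | ih x => simp [hA]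
  · intro a b
    ext x
    induction x using induction_on with
    | hp => apply isClosed_eq <;> fun_prop
    | ih x => simp [hA]
  · ext x
    induction x using induction_on with
    | hp => apply isClosed_eq <;> fun_prop
    | ih x => simp [hA, coe_zero]
  · intro a b
    ext x
    induction x using induction_on with
    | hp => apply isClosed_eq <;> fun_prop
    | ih x => simp [hA, coe_add]
  · intro r
    ext x
    induction x using induction_on with
    | hp => apply isClosed_eq <;> fun_prop
    | ih x => simp [hA, Algebra.algebraMap_eq_smul_one]
  · intro a
    refine (eq_adjoint_iff _ _).mpr fun x y => ?_
    induction x, y using induction_on₂ with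
    | hp => apply isClosed_eq <;> fun_prop
    | ih x y => simp [hA, hL']
  · intro x y
    exact inner_coe x y
  · intro c x
    exact Completion.map_coe (A c).uniformContinuous x

end GNS

/-! ### Extension of positive functionals and dilation of ucp maps. -/

section Extension

variable {C : Type v} [CStarAlgebra C] {b : Type u}

theorem cstarPos_smul {n : ℕ} {r : ℝ} (hr : 0 ≤ r) {M : Matrix (Fin n) (Fin n) C}
    (hM : CStarPos M) : CStarPos (r • M) := by
  obtain ⟨N, rfl⟩ := hM
  refine ⟨√r • N, ?_⟩
  rw [Matrix.conjTranspose_smul, star_trivial, smul_mul_smul_comm, Real.mul_self_sqrt hr]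

theorem cstarPos_star_mul {n : ℕ} (x : Fin n → C) :
    CStarPos (Matrix.of fun i j => star (x i) * x j) := by
  rcases n with _ | n
  · exact ⟨0, Subsingleton.elim _ _⟩
  refine ⟨Matrix.of fun k j => if k = 0 then x j else 0, ?_⟩
  ext i j
  rw [Matrix.mul_apply, Finset.sum_eq_single 0] <;> simp +contextual

/-- The finitely supported matrices over `C` whose real part is positive. -/
def positiveRealPartCone (b : Type u) (C : Type v) [CStarAlgebra C] :
    PointedCone ℝ (b × b →₀ C) where
  carrier := {y | ∀ (n : ℕ) (e : Fin n → b),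
    CStarPos (Matrix.of fun i j => y (e i, e j) + star (y (e j, e i)))}
  add_mem' := by
    intro y z hy hz n e
    convert cstarPos_add (hy n e) (hz n e) using 1
    ext i j
    simp only [Finsupp.add_apply, star_add, Matrix.of_apply, Matrix.add_apply]
    abel
  zero_mem' := fun n e => ⟨0, by ext; simp⟩
  smul_mem' := by
    intro r y hy n e
    convert cstarPos_smul r.2 (hy n e) using 1
    ext i j
    change (r : ℝ) • y (e i, e j) + star ((r : ℝ) • y (e j, e i)) = _
    rw [star_smul, star_trivial, ← smul_add]
    rfl

/-- The matrix `(xᵢ* yⱼ)`. -/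
noncomputable def starMulMatrix (x y : b →₀ C) : b × b →₀ C :=
  Finsupp.onFinset (x.support ×ˢ y.support) (fun p => star (x p.1) * y p.2) fun p hp => by
    simp only [Finset.mem_product, Finsupp.mem_support_iff]
    constructor <;> rintro h <;> simp [h] at hp

@[simp]
theorem starMulMatrix_apply (x y : b →₀ C) (p : b × b) :
    starMulMatrix x y p = star (x p.1) * y p.2 := rfl

theorem starMulMatrix_self_mem (x : b →₀ C) : starMulMatrix x x ∈ positiveRealPartCone b C := by
  intro n e
  convert cstarPos_add (cstarPos_star_mul fun i => x (e i)) (cstarPos_star_mul fun i => x (e i))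
    using 1
  ext i j
  simp

/-- This is the domination hypothesis of the Riesz extension theorem: scalar diagonal matrices,
which lie over every operator system in `C`, absorb any entry `c`. Twice the real part of the sum is
`z* z + w* w` for the rows `z = c* eᵢ + eⱼ` and `w = d eᵢ`, where `d* d = ‖c‖² - c c*`. -/
theorem exists_add_single_mem_positiveRealPartCone (i j : b) (c : C) :
    ∃ r s : ℝ, Finsupp.single (i, i) ((r : ℂ) • 1) + Finsupp.single (j, j) ((s : ℂ) • 1)
      + Finsupp.single (i, j) c ∈ positiveRealPartCone b C := by
  classical
  let _ := CStarAlgebra.spectralOrder C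
  let _ := CStarAlgebra.spectralOrderedRing C
  have hd : 0 ≤ algebraMap ℝ C (‖c‖ ^ 2) - c * star c := by
    rw [sub_nonneg, sq, ← CStarRing.norm_self_mul_star (x := c)]
    exact (IsSelfAdjoint.mul_star_self c).le_algebraMap_norm_self
  obtain ⟨d, hd⟩ := (nonneg_iff_exists_star_mul_self _).1 hd
  have hc : ((‖c‖ ^ 2 : ℝ) : ℂ) • (1 : C) = c * star c + star d * d := by
    rw [← hd, Algebra.algebraMap_eq_smul_one, Complex.coe_smul, add_sub_cancel]
  let z : b →₀ C := Finsupp.single i (star c) + Finsupp.single j 1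
  let w : b →₀ C := Finsupp.single i d
  -- The cone tests `y + y*`, which doubles the diagonal; hence the halves.
  refine ⟨‖c‖ ^ 2 / 2, 1 / 2, fun n e => ?_⟩
  convert cstarPos_add (cstarPos_star_mul fun i => z (e i)) (cstarPos_star_mul fun i => w (e i))
    using 1
  ext k l
  have h1 : ((1 / 2 : ℝ) : ℂ) • (1 : C) + ((1 / 2 : ℝ) : ℂ) • (1 : C) = 1 := by
    rw [← add_smul]; norm_num
  have h2 : ((‖c‖ ^ 2 / 2 : ℝ) : ℂ) • (1 : C) + ((‖c‖ ^ 2 / 2 : ℝ) : ℂ) • (1 : C)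
      = c * star c + star d * d := by
    rw [← hc, ← add_smul]; push_cast; ring_nf
  have hs : ∀ r : ℝ, star ((r : ℂ) • (1 : C)) = (r : ℂ) • 1 := by intro r; simp [star_smul]
  have hs₁ := hs (1 / 2)
  have hs₂ := hs (‖c‖ ^ 2 / 2)
  generalize ((1 / 2 : ℝ) : ℂ) • (1 : C) = p at *
  generalize ((‖c‖ ^ 2 / 2 : ℝ) : ℂ) • (1 : C) = q at *
  have h2' : c * star c = q + q - star d * d := by rw [h2, add_sub_cancel_right]
  simp only [Matrix.of_apply, Matrix.add_apply, Finsupp.add_apply, Finsupp.single_apply,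
    Prod.mk.injEq, z, w]
  -- Neither `i ≠ j` nor injectivity of `e` is assumed, so all sixteen patterns of coincidence are
  -- checked.
  rcases Classical.propComplete (i = e k) with hik | hik <;>
    rcases Classical.propComplete (i = e l) with hil | hil <;>
    rcases Classical.propComplete (j = e k) with hjk | hjk <;>
    rcases Classical.propComplete (j = e l) with hjl | hjl
  all_goals
    simp only [hik, hil, hjk, hjl, if_true, if_false, and_true, and_false, star_add, hs₁, hs₂,
      star_zero, star_star, star_one, mul_add, add_mul, add_zero, zero_add, mul_one, one_mul,
      mul_zero, zero_mul]
  all_goals try simp only [h2', ← h1]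
  all_goals abel


/-- An anti-hermitian matrix has zero real part, so it and its negative both lie in the cone. This
makes the extended functional hermitian. -/
theorem map_eq_zero_of_forall_nonneg {g : (b × b →₀ C) →ₗ[ℝ] ℝ}
    (hg : ∀ y ∈ positiveRealPartCone b C, 0 ≤ g y) {y : b × b →₀ C}
    (hy : ∀ p, star (y p.swap) = -y p) : g y = 0 := by
  have hmem : ∀ z : b × b →₀ C, (∀ p, star (z p.swap) = -z p) → 0 ≤ g z := by
    intro z hz
    refine hg z fun n e => ⟨0, ?_⟩
    ext i j
    have := hz (e i, e j)
    simp only [Prod.swap_prod_mk] at this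
    simp [this]
  refine le_antisymm ?_ (hmem y hy)
  have := hmem (-y) fun p => by simp [hy p]
  simpa using this

variable {T : Type w} [AddCommGroup T] [Module ℂ T]
variable {H : Type u} [NormedAddCommGroup H] [InnerProductSpace ℂ H]

/-- The functional on finitely supported matrices over `T` that is defined by a linear map to `B(H)`
and a family of vectors of `H`. -/
noncomputable def matrixFunctional (φ : T →ₗ[ℂ] (H →L[ℂ] H)) (e : b → H) :
    (b × b →₀ T) →ₗ[ℂ] ℂ :=
  Finsupp.lsum ℂ fun p =>
    { toFun := fun t => inner ℂ (e p.1) (φ t (e p.2))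
      map_add' := fun s t => by simp
      map_smul' := fun c t => by simp }

theorem matrixFunctional_single (φ : T →ₗ[ℂ] (H →L[ℂ] H)) (e : b → H) (i j : b) (t : T) :
    matrixFunctional φ e (Finsupp.single (i, j) t) = inner ℂ (e i) (φ t (e j)) := by
  simp [matrixFunctional]

variable [StarAddMonoid T] [StarModule ℂ T] [One T] [OperatorSystem T] [CompleteSpace H]

theorem IsCompleteOrderEmbedding.injective {ρ : T →ₗ[ℂ] C} (hρ : IsCompleteOrderEmbedding ρ) :
    Function.Injective ρ := by
  rw [injective_iff_map_eq_zero]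
  have h1 : ∀ y : T, ρ y = 0 → y = 0 := by
    intro y hy
    have h0 : OperatorSystem.IsPos (0 : Matrix (Fin 1) (Fin 1) C) := OperatorSystem.zero 1
    have h := OperatorSystem.proper (M := Matrix.of fun _ _ : Fin 1 => y)
      ((hρ.map_pos_iff _).1 (by convert h0; ext; simp [hy]))
      ((hρ.map_pos_iff _).1 (by convert h0; ext; simp [hy]))
    exact congrFun (congrFun h 0) 0
  exact h1

/-- The order embedding reflects positivity of `M + M*` from `C` to `T`, `φ` preserves it, and the
quadratic form of the image at the vectors `e` is twice the real part in question. -/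
theorem re_matrixFunctional_nonneg {φ : T →ₗ[ℂ] (H →L[ℂ] H)} (hφ : IsUCP φ) (e : b → H)
    {ρ : T →ₗ[ℂ] C} (hρ : IsCompleteOrderEmbedding ρ) (M : b × b →₀ T)
    (hM : Finsupp.mapRange.linearMap ρ M ∈ positiveRealPartCone b C) :
    0 ≤ (matrixFunctional φ e M).re := by
  classical
  -- `F` contains every row and column index of the support, so a single finite principal submatrix
  -- carries all of `M`.
  let F : Finset b := M.support.image Prod.fst ∪ M.support.image Prod.snd
  let f : Fin F.card → b := fun i => F.equivFin.symm i
  have hf : ∀ g : b → ℂ, ∑ i, g (f i) = ∑ p ∈ F, g p := by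
    intro g
    rw [← Finset.sum_coe_sort F g]
    exact Equiv.sum_comp F.equivFin.symm fun p : F => g p
  have hsum : matrixFunctional φ e M
      = ∑ i, ∑ j, inner ℂ (e (f i)) (φ (M (f i, f j)) (e (f j))) := by
    have h1 : ∀ p, ∑ j, inner ℂ (e p) (φ (M (p, f j)) (e (f j)))
        = ∑ q ∈ F, inner ℂ (e p) (φ (M (p, q)) (e q)) := fun p =>
      hf fun q => inner ℂ (e p) (φ (M (p, q)) (e q))
    simp only [h1]
    rw [hf fun p => ∑ q ∈ F, inner ℂ (e p) (φ (M (p, q)) (e q)), ← Finset.sum_product']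
    rw [matrixFunctional, Finsupp.lsum_apply, Finsupp.sum]
    refine Finset.sum_subset (fun p hp => ?_) fun p _ hp => ?_
    · exact Finset.mem_product.2
        ⟨Finset.mem_union_left _ (Finset.mem_image_of_mem _ hp),
          Finset.mem_union_right _ (Finset.mem_image_of_mem _ hp)⟩
    · simp [Finsupp.notMem_support_iff.1 hp]
  let N : Matrix (Fin F.card) (Fin F.card) T :=
    Matrix.of fun i j => M (f i, f j) + star (M (f j, f i))
  have hN : OperatorSystem.IsPos N := by
    rw [← hρ.map_pos_iff]
    have h : N.map ρ = Matrix.of fun i j => Finsupp.mapRange.linearMap ρ M (f i, f j)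
        + star (Finsupp.mapRange.linearMap ρ M (f j, f i)) := by
      ext i j
      simp [N, hρ.isUCP.map_star]
    rw [h]
    exact hM _ f
  have h := (show CStarPos (N.map φ) from hφ.map_pos N hN).re_sum_inner_nonneg fun i => e (f i)
  have h2 : ∑ i, ∑ j, inner ℂ (e (f i)) ((N.map φ) i j (e (f j)))
      = matrixFunctional φ e M + starRingEnd ℂ (matrixFunctional φ e M) := by
    rw [hsum]
    simp only [N, Matrix.map_apply, Matrix.of_apply, map_add, hφ.map_star, add_apply,
      inner_add_right, Finset.sum_add_distrib, map_sum, ContinuousLinearMap.star_eq_adjoint,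
      ContinuousLinearMap.adjoint_inner_right]
    congr 1
    rw [Finset.sum_comm]
    simp only [inner_conj_symm]
  rw [h2, Complex.add_re, Complex.conj_re] at h
  linarith

/-- A unital completely positive map `φ : T → B(H)` on an operator system in `C` defines a positive
functional on finitely supported matrices over `T`, which extends to matrices over `C`. -/
theorem exists_positive_functional {φ : T →ₗ[ℂ] (H →L[ℂ] H)} (hφ : IsUCP φ) (e : b → H)
    {ρ : T →ₗ[ℂ] C} (hρ : IsCompleteOrderEmbedding ρ) :
    ∃ g : (b × b →₀ C) →ₗ[ℂ] ℂ,
      (∀ i j t, g (Finsupp.single (i, j) (ρ t)) = inner ℂ (e i) (φ t (e j))) ∧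
      (∀ x, 0 ≤ (g (starMulMatrix x x)).re) ∧
      ∀ x y, starRingEnd ℂ (g (starMulMatrix y x)) = g (starMulMatrix x y) := by
  let ρ' : (b × b →₀ T) →ₗ[ℂ] (b × b →₀ C) := Finsupp.mapRange.linearMap ρ
  have hρ' : Function.Injective (ρ'.restrictScalars ℝ) :=
    Finsupp.mapRange_injective ρ (map_zero ρ) hρ.injective
  let E := LinearEquiv.ofInjective (ρ'.restrictScalars ℝ) hρ'
  let f : (b × b →₀ C) →ₗ.[ℝ] ℝ :=
    ⟨LinearMap.range (ρ'.restrictScalars ℝ),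
      Complex.reLm ∘ₗ (matrixFunctional φ e).restrictScalars ℝ ∘ₗ E.symm.toLinearMap⟩
  have hE : ∀ M, f (E M) = (matrixFunctional φ e M).re := by
    intro M
    change (matrixFunctional φ e (E.symm (E M))).re = _
    rw [E.symm_apply_apply]
  -- M. Riesz extension over `ℝ`, from matrices over `T` to matrices over `C`. The dominating
  -- diagonal matrices are in the domain because `ρ 1 = 1`.
  obtain ⟨g, hgf, hg⟩ := riesz_extension (positiveRealPartCone b C) f
    (fun x hx => by
      obtain ⟨M, rfl⟩ := E.surjective x
      rw [hE]
      exact re_matrixFunctional_nonneg hφ e hρ M hx)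
    (fun y => by
      induction y using Finsupp.induction_linear with
      | zero => exact ⟨0, by simp⟩
      | add y z hy hz =>
        obtain ⟨y', hy⟩ := hy
        obtain ⟨z', hz⟩ := hz
        refine ⟨y' + z', ?_⟩
        rw [Submodule.coe_add, add_add_add_comm]
        exact add_mem hy hz
      | single p c =>
        obtain ⟨r, s, h⟩ := exists_add_single_mem_positiveRealPartCone p.1 p.2 c
        refine ⟨E (Finsupp.single (p.1, p.1) ((r : ℂ) • 1)
          + Finsupp.single (p.2, p.2) ((s : ℂ) • 1)), ?_⟩
        convert h using 2
        change ρ' _ = _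
        simp only [ρ', map_add, Finsupp.mapRange.linearMap_apply, Finsupp.mapRange_single, map_smul,
          hρ.map_one])
  have hgT : ∀ M, g (ρ' M) = (matrixFunctional φ e M).re := fun M => (hgf (E M)).trans (hE M)
  -- The complex functional with real part `g`; its imaginary part at `y` is `-g (i y)`.
  refine ⟨Module.Dual.extendRCLike g, fun i j t => ?_, fun x => ?_, fun x y => ?_⟩
  · have h1 : g (Finsupp.single (i, j) (ρ t)) = (inner ℂ (e i) (φ t (e j))).re := by
      have := hgT (Finsupp.single (i, j) t)
      rwa [matrixFunctional_single, Finsupp.mapRange.linearMap_apply,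
        Finsupp.mapRange_single] at this
    have h2 : g (Complex.I • Finsupp.single (i, j) (ρ t)) = -(inner ℂ (e i) (φ t (e j))).im := by
      have := hgT (Complex.I • Finsupp.single (i, j) t)
      rw [map_smul ρ', map_smul (matrixFunctional φ e), matrixFunctional_single,
        Finsupp.mapRange.linearMap_apply, Finsupp.mapRange_single] at this
      simpa using this
    apply Complex.ext
    · exact (Module.Dual.re_extendRCLike_apply (𝕜 := ℂ) g _).trans h1
    · refine (Module.Dual.im_extendRCLike_apply (𝕜 := ℂ) g _).trans ?_
      rw [RCLike.I_to_complex, h2, neg_neg]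
  · have := Module.Dual.re_extendRCLike_apply (𝕜 := ℂ) g (starMulMatrix x x)
    exact (hg _ (starMulMatrix_self_mem x)).trans_eq this.symm
  -- The two matrices are adjoint to each other, so their difference and `i` times their sum are
  -- anti-hermitian and are killed by `g`.
  · have h1 : g (starMulMatrix y x) = g (starMulMatrix x y) := by
      rw [← sub_eq_zero, ← map_sub]
      exact map_eq_zero_of_forall_nonneg hg fun p => by simp
    have h2 : g (Complex.I • starMulMatrix y x) = -g (Complex.I • starMulMatrix x y) := by
      rw [← sub_eq_zero, sub_neg_eq_add, ← map_add]
      exact map_eq_zero_of_forall_nonneg hg fun p => by simp [add_comm]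
    apply Complex.ext
    · rw [Complex.conj_re]
      exact (Module.Dual.re_extendRCLike_apply (𝕜 := ℂ) g _).trans
        (h1.trans (Module.Dual.re_extendRCLike_apply (𝕜 := ℂ) g _).symm)
    · rw [Complex.conj_im]
      have h3 := Module.Dual.im_extendRCLike_apply (𝕜 := ℂ) g (starMulMatrix y x)
      have h4 := Module.Dual.im_extendRCLike_apply (𝕜 := ℂ) g (starMulMatrix x y)
      rw [RCLike.I_to_complex] at h3 h4
      rw [h2, neg_neg] at h3
      exact (congrArg Neg.neg h3).trans h4.symm

/-- A unital completely positive map on an operator system in `C` dilates to a *-representation of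
`C` (the extension theorem of Arveson together with the dilation theorem of Stinespring). -/
theorem IsUCP.exists_dilation {C : Type u} [CStarAlgebra C] {φ : T →ₗ[ℂ] (H →L[ℂ] H)}
    (hφ : IsUCP φ) {ρ : T →ₗ[ℂ] C} (hρ : IsCompleteOrderEmbedding ρ) :
    ∃ (K : Type u) (_ : NormedAddCommGroup K) (_ : InnerProductSpace ℂ K) (_ : CompleteSpace K)
      (σ : C →⋆ₐ[ℂ] (K →L[ℂ] K)) (V : H →ₗᵢ[ℂ] K), ∀ t, compression σ V (ρ t) = φ t := by
  -- Indexing by the vectors of `H` themselves makes `H →₀ C` a stand-in for the algebraic tensor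
  -- product `C ⊗ H`.
  obtain ⟨g, hg, hg0, hgs⟩ := exists_positive_functional hφ (id : H → H) hρ
  let core : PreInnerProductSpace.Core ℂ (H →₀ C) :=
    { inner := fun x y => g (starMulMatrix x y)
      conj_inner_symm := hgs
      re_inner_nonneg := hg0
      add_left := fun x y z => by
        rw [← map_add]
        congr 1
        ext p
        simp [add_mul]
      smul_left := fun x y r => by
        rw [← smul_eq_mul, ← map_smul]
        congr 1
        ext p
        simp }
  let L : C →ₐ[ℂ] Module.End ℂ (H →₀ C) :=
    AlgHom.ofLinearMap
      { toFun := fun c => Finsupp.mapRange.linearMap (LinearMap.mulLeft ℂ c)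
        map_add' := fun a b => LinearMap.ext fun x => Finsupp.ext fun h => by simp [add_mul]
        map_smul' := fun r a => LinearMap.ext fun x => Finsupp.ext fun h => by simp }
      (LinearMap.ext fun x => Finsupp.ext fun h => by simp)
      (fun a b => LinearMap.ext fun x => Finsupp.ext fun h => by simp)
  have hLs : ∀ c h a, L c (Finsupp.single h a) = Finsupp.single h (c * a) := by
    intro c h a
    simp [L]
  obtain ⟨K, _, _, _, σ, j, hj, hσ⟩ := exists_starAlgHom_of_preInnerProductSpace core L
    (fun c x y => by
      change g _ = g _
      congr 1
      ext p
      simp [L, mul_assoc])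
  have hs : ∀ h k : H, ∀ c : C, starMulMatrix (Finsupp.single h 1) (Finsupp.single k c)
      = Finsupp.single (h, k) c := by
    classical
    intro h k c
    ext p
    obtain ⟨p, q⟩ := p
    by_cases hp : h = p <;> by_cases hq : k = q <;> simp [hp, hq]
  have hjs : ∀ h k : H, ∀ t, inner ℂ (j (Finsupp.single h 1)) (j (Finsupp.single k (ρ t)))
      = inner ℂ h (φ t k) := by
    intro h k t
    rw [hj]
    change g _ = _
    rw [hs, hg]
    rfl
  have hj1 : ∀ h k : H, inner ℂ (j (Finsupp.single h 1)) (j (Finsupp.single k 1))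
      = inner ℂ h k := by
    intro h k
    have := hjs h k 1
    rwa [hρ.map_one, hφ.map_one] at this
  -- `h ↦ single h 1` is not linear, but the defects of linearity have norm zero by `hj1`, so they
  -- vanish in `K`.
  let V : H →ₗᵢ[ℂ] K := LinearMap.isometryOfInner
    { toFun := fun h => j (Finsupp.single h 1)
      map_add' := fun h k => by
        rw [← sub_eq_zero, ← inner_self_eq_zero (𝕜 := ℂ)]
        simp only [inner_sub_left, inner_sub_right, inner_add_left, inner_add_right, hj1]
        ring
      map_smul' := fun c h => by
        rw [RingHom.id_apply, ← sub_eq_zero, ← inner_self_eq_zero (𝕜 := ℂ)]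
        simp only [inner_sub_left, inner_sub_right, inner_smul_left, inner_smul_right, hj1]
        ring } hj1
  refine ⟨K, _, _, _, σ, V, fun t => ?_⟩
  ext k
  refine ext_inner_left ℂ fun h => ?_
  rw [← hjs, compression_apply]
  simp only [ContinuousLinearMap.comp_apply, ContinuousLinearMap.adjoint_inner_right]
  change inner ℂ (j (Finsupp.single h 1)) (σ (ρ t) (j (Finsupp.single k 1))) = _
  rw [hσ, hLs, mul_one]

end Extension

/-! ### Closed ranges and factorization of *-homomorphisms. -/

section Range

variable {A : Type u} {B : Type v} [CStarAlgebra A] [CStarAlgebra B]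

theorem StarAlgHom.continuous_of_cstarAlgebra (f : A →⋆ₐ[ℂ] B) : Continuous f :=
  AddMonoidHomClass.continuous_of_bound f 1 (by simpa using NonUnitalStarAlgHom.norm_apply_le f)

/-- Truncate `a` by functional calculus at height `‖f a‖`. The truncation is the identity on the
spectrum of `f a`, so the image under `f` does not change. -/
theorem StarAlgHom.exists_selfAdjoint_norm_le (f : A →⋆ₐ[ℂ] B) {a : A} (ha : IsSelfAdjoint a) :
    ∃ a', f a' = f a ∧ ‖a'‖ ≤ ‖f a‖ := by
  let r := ‖f a‖
  let h : ℝ → ℝ := fun x => max (-r) (min x r)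
  have hr : 0 ≤ r := norm_nonneg _
  have hc : Continuous h := by fun_prop
  refine ⟨cfc h a, ?_, ?_⟩
  · rcases subsingleton_or_nontrivial B with _ | _
    · exact Subsingleton.elim _ _
    rw [StarAlgHomClass.map_cfc f h a hc.continuousOn f.continuous_of_cstarAlgebra ha (ha.map f)]
    conv_rhs => rw [← cfc_id ℝ (f a) (ha.map f)]
    refine cfc_congr fun x hx => ?_
    have := abs_le.1 ((Real.norm_eq_abs x).symm.le.trans (spectrum.norm_le_norm_of_mem hx))
    simp only [h, r, id]
    rw [min_eq_left this.2, max_eq_right this.1]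
  · refine norm_cfc_le hr fun x _ => ?_
    rw [Real.norm_eq_abs, abs_le]
    exact ⟨le_max_left _ _, max_le (by linarith) (min_le_right _ _)⟩

/-- Lift real and imaginary parts separately; each costs at most `‖f a‖`. Any fixed constant would
serve for closedness of the range. -/
theorem StarAlgHom.exists_norm_le_two_mul (f : A →⋆ₐ[ℂ] B) (a : A) :
    ∃ a', f a' = f a ∧ ‖a'‖ ≤ 2 * ‖f a‖ := by
  obtain ⟨x, hx, hx'⟩ := f.exists_selfAdjoint_norm_le (realPart a).2
  obtain ⟨y, hy, hy'⟩ := f.exists_selfAdjoint_norm_le (imaginaryPart a).2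
  have h1 : ‖f (realPart a : A)‖ ≤ ‖f a‖ := by
    rw [realPart_apply_coe, ← Complex.coe_smul, map_smul, map_add, map_star, norm_smul]
    have := norm_add_le (f a) (star (f a))
    rw [norm_star] at this
    norm_num
    linarith
  have h2 : ‖f (imaginaryPart a : A)‖ ≤ ‖f a‖ := by
    rw [imaginaryPart_apply_coe, ← Complex.coe_smul, map_smul, map_smul, map_sub, map_star,
      norm_smul, norm_smul]
    have := norm_sub_le (f a) (star (f a))
    rw [norm_star] at this
    norm_num
    linarith
  refine ⟨x + Complex.I • y, ?_, ?_⟩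
  · rw [map_add, map_smul, hx, hy, ← map_smul, ← map_add, realPart_add_I_smul_imaginaryPart]
  · have := norm_add_le x (Complex.I • y)
    rw [norm_smul, Complex.norm_I, one_mul] at this
    linarith

/-- A *-homomorphism of C*-algebras whose range contains a generating set is surjective. -/
theorem StarAlgHom.surjective_of_adjoin (f : A →⋆ₐ[ℂ] B) {s : Set B}
    (hs : (StarAlgebra.adjoin ℂ s).topologicalClosure = ⊤) (hf : s ⊆ Set.range f) :
    Function.Surjective f := by
  let F : NormedAddGroupHom A B :=
    { toFun := f
      map_add' := map_add f
      bound' := ⟨1, by simpa using NonUnitalStarAlgHom.norm_apply_le f⟩ }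
  -- Preimages of controlled norm and completeness of `A` make every limit of values of `f` a value
  -- of `f`.
  have h := controlled_closure_of_complete (f := F) (K := F.range) two_pos one_pos (by
    rintro _ ⟨a, rfl⟩
    exact f.exists_norm_le_two_mul a)
  intro y
  have hle : StarAlgebra.adjoin ℂ s ≤ f.range := StarAlgebra.adjoin_le hf
  have hy : y ∈ (StarAlgebra.adjoin ℂ s).topologicalClosure := by
    rw [hs]; exact StarSubalgebra.mem_top
  have hy' : y ∈ F.range.topologicalClosure := closure_mono (fun z hz => hle hz) hy
  obtain ⟨a, ha, -⟩ := h y hy'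
  exact ⟨a, ha⟩

/-- A *-homomorphism with values in the range of an injective *-homomorphism `J` factors
through `J`. -/
theorem StarAlgHom.exists_lift {C : Type w} [CStarAlgebra C] (J : A →⋆ₐ[ℂ] B)
    (hJ : Function.Injective J) (P : C →⋆ₐ[ℂ] B) (hP : ∀ c, P c ∈ Set.range J) :
    ∃ Q : C →⋆ₐ[ℂ] A, ∀ c, J (Q c) = P c := by
  choose q hq using hP
  exact ⟨
    { toFun := q
      map_one' := hJ (by rw [hq, map_one, map_one])
      map_mul' := fun a b => hJ (by rw [map_mul, hq, hq, hq, map_mul])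
      map_zero' := hJ (by rw [hq, map_zero, map_zero])
      map_add' := fun a b => hJ (by rw [map_add, hq, hq, hq, map_add])
      commutes' := fun r => hJ (by
        simp only [hq, Algebra.algebraMap_eq_smul_one, map_smul, map_one])
      map_star' := fun a => hJ (by rw [map_star, hq, hq, map_star]) }, hq⟩

/-- A set generates a C*-algebra if every closed *-subalgebra that contains it is everything. -/
theorem StarAlgebra.topologicalClosure_adjoin_eq_top {s : Set A}
    (h : ∀ B : StarSubalgebra ℂ A, IsClosed (B : Set A) → s ⊆ B → B = ⊤) :
    (StarAlgebra.adjoin ℂ s).topologicalClosure = ⊤ :=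
  h _ (StarSubalgebra.isClosed_topologicalClosure _)
    ((StarAlgebra.subset_adjoin ℂ s).trans (StarSubalgebra.le_topologicalClosure _))

end Range

/-! ### Hyperrigidity identifies the C*-envelope. -/

section Envelope

open ContinuousLinearMap

theorem IsUCP.comp {Q : Type u} [AddCommGroup Q] [Module ℂ Q] [StarAddMonoid Q] [StarModule ℂ Q]
    [One Q] [OperatorSystem Q] {S : Type v} [AddCommGroup S] [Module ℂ S] [StarAddMonoid S]
    [StarModule ℂ S] [One S] [OperatorSystem S] {R : Type w} [AddCommGroup R] [Module ℂ R] [StarAddMonoid R]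
    [StarModule ℂ R] [One R] [OperatorSystem R] {ψ : S →ₗ[ℂ] R} {φ : Q →ₗ[ℂ] S} (hψ : IsUCP ψ)
    (hφ : IsUCP φ) : IsUCP (ψ ∘ₗ φ) where
  map_one := by rw [LinearMap.comp_apply, hφ.map_one, hψ.map_one]
  map_pos M hM := by
    have := hψ.map_pos _ (hφ.map_pos M hM)
    rwa [Matrix.map_map] at this

variable {T : Type u} [AddCommGroup T] [Module ℂ T]

/-- A representation of `A` is the only ucp map that agrees with it on a hyperrigid subsystem. -/
theorem IsHyperrigid.eq_of_isUCP {A : Type u} [CStarAlgebra A] {ι : T →ₗ[ℂ] A}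
    (hι : IsHyperrigid ι) {H : Type u} [NormedAddCommGroup H] [InnerProductSpace ℂ H]
    [CompleteSpace H] (π : A →⋆ₐ[ℂ] (H →L[ℂ] H)) {ψ : A →ₗ[ℂ] (H →L[ℂ] H)} (hψ : IsUCP ψ)
    (h : ∀ t, ψ (ι t) = π (ι t)) (a : A) : ψ a = π a := by
  -- The unique extension property only yields some representation `π'`; both `ψ` and `π` are ucp
  -- extensions, so both equal it.
  obtain ⟨π', -, hπ'⟩ := hι H π
  rw [hπ' ψ hψ h a]
  exact (hπ' π (isUCP_starAlgHom π) (fun _ => rfl) a).symm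

theorem IsHyperrigid.of_starAlgEquiv {E F : Type u} [CStarAlgebra E] [CStarAlgebra F]
    {ι : T →ₗ[ℂ] E} {j : T →ₗ[ℂ] F} (hι : IsHyperrigid ι) (Φ : F ≃⋆ₐ[ℂ] E)
    (hΦ : ∀ t, Φ (j t) = ι t) : IsHyperrigid j := by
  intro H _ _ _ π
  let Ψ : E →⋆ₐ[ℂ] F := (Φ.symm : E →⋆ₐ[ℂ] F)
  have hΨΦ : ∀ c, Ψ (Φ c) = c := Φ.symm_apply_apply
  have hΨ : ∀ t, Ψ (ι t) = j t := fun t => by rw [← hΦ, hΨΦ]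
  refine ⟨π, fun _ => rfl, fun ψ hψ h c => ?_⟩
  have := hι.eq_of_isUCP (π.comp Ψ) (hψ.comp (isUCP_starAlgHom Ψ))
    (fun t => by
      change ψ (Ψ (ι t)) = π (Ψ (ι t))
      rw [hΨ]
      exact h t) (Φ c)
  change ψ (Ψ (Φ c)) = π (Ψ (Φ c)) at this
  rwa [hΨΦ] at this

variable [StarAddMonoid T] [StarModule ℂ T] [One T] [OperatorSystem T]

/-- If the compression of a representation `τ` is a representation `π`, then the isometry
intertwines `π` and `τ`. -/
theorem apply_isometry_eq_of_compression_eq {A : Type w} [CStarAlgebra A]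
    {H : Type u} [NormedAddCommGroup H] [InnerProductSpace ℂ H] [CompleteSpace H]
    {K : Type v} [NormedAddCommGroup K] [InnerProductSpace ℂ K] [CompleteSpace K]
    {τ : A →⋆ₐ[ℂ] (K →L[ℂ] K)} {π : A →⋆ₐ[ℂ] (H →L[ℂ] H)} {V : H →ₗᵢ[ℂ] K}
    (h : ∀ a, compression τ V a = π a) (a : A) (x : H) : τ a (V x) = V (π a x) := by
  refine apply_isometry_eq_of_compression V (h a) ?_ x
  rw [← map_star, ← map_star, ← map_mul, ← map_mul]
  exact h _

/-- A representation of `A` restricted to a hyperrigid subsystem extends to a representation of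
every other C*-cover of the subsystem. -/
theorem IsHyperrigid.exists_starAlgHom_cover {A : Type u} [CStarAlgebra A] {ι : T →ₗ[ℂ] A}
    (hι : IsHyperrigid ι) (hcover : IsCStarCover ι) {C : Type u} [CStarAlgebra C] {ρ : T →ₗ[ℂ] C}
    (hρ : IsCStarCover ρ) {H : Type u} [NormedAddCommGroup H] [InnerProductSpace ℂ H]
    [CompleteSpace H] (π : A →⋆ₐ[ℂ] (H →L[ℂ] H)) :
    ∃ π' : C →⋆ₐ[ℂ] (H →L[ℂ] H), ∀ t, π' (ρ t) = π (ι t) := by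
  -- Dilate twice, to `C` and back to `A`: hyperrigidity can only be applied to maps on `A`.
  obtain ⟨K, _, _, _, σ, V, hσ⟩ :=
    ((isUCP_starAlgHom π).comp hcover.embedding.isUCP).exists_dilation hρ.embedding
  obtain ⟨L, _, _, _, τ, W, hτ⟩ :=
    ((isUCP_starAlgHom σ).comp hρ.embedding.isUCP).exists_dilation hcover.embedding
  have hWV : ∀ a x, compression τ (W.comp V) a x
      = adjoint V.toContinuousLinearMap (compression τ W a (V x)) := by
    intro a x
    refine ext_inner_left ℂ fun y => ?_
    simp [compression_apply, adjoint_inner_right]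
  have hcomp : ∀ a, compression τ (W.comp V) a = π a := by
    refine hι.eq_of_isUCP π (isUCP_compression τ (W.comp V)) fun t => ?_
    ext x
    rw [hWV, hτ]
    exact congrArg (fun A : H →L[ℂ] H => A x) (hσ t)
  -- `H` is invariant under `τ (ι t)`, and `σ (ρ t)` is the compression of `τ (ι t)` to `K`, so the
  -- invariance descends.
  have hinv : ∀ t x, σ (ρ t) (V x) = V (π (ι t) x) := by
    intro t x
    have h1 : compression τ W (ι t) (V x) = σ (ρ t) (V x) := by rw [hτ]; rfl
    have h2 : τ (ι t) (W (V x)) = W (V (π (ι t) x)) :=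
      apply_isometry_eq_of_compression_eq hcomp (ι t) x
    rw [← h1, compression_apply, comp_apply, comp_apply, LinearIsometry.coe_toContinuousLinearMap,
      h2]
    exact congrArg (fun A : K →L[ℂ] K => A (V (π (ι t) x))) W.adjoint_comp_self
  obtain ⟨π', hπ'⟩ := exists_starAlgHom_eq_compression σ V hρ.generates
    (by rintro _ ⟨t, rfl⟩; exact ⟨star t, hρ.embedding.isUCP.map_star t⟩)
    (by rintro _ ⟨t, rfl⟩ x; exact ⟨_, hinv t x⟩)
  exact ⟨π', fun t => (hπ' _).trans (hσ t)⟩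

/-- A C*-algebra that is represented faithfully by operators is the C*-envelope of every hyperrigid
generating subsystem. -/
theorem IsHyperrigid.isCStarEnvelope {A : Type u} [CStarAlgebra A] {ι : T →ₗ[ℂ] A}
    (hι : IsHyperrigid ι) (hcover : IsCStarCover ι) {I : Type u} {H : I → Type u}
    [∀ i, NormedAddCommGroup (H i)] [∀ i, InnerProductSpace ℂ (H i)] [∀ i, CompleteSpace (H i)]
    [∀ i, Nontrivial (H i)] (J : A →⋆ₐ[ℂ] lp (fun i => H i →L[ℂ] H i) ∞) (hJ : Function.Injective J) :
    IsCStarEnvelope ι where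
  cover := hcover
  universal C _ ρ hρ := by
    let _ : CStarAlgebra (lp (fun i => H i →L[ℂ] H i) ∞) := {}
    let ev : ∀ i, lp (fun i => H i →L[ℂ] H i) ∞ →⋆ₐ[ℂ] (H i →L[ℂ] H i) := fun i =>
      { toFun := fun x => x i
        map_one' := rfl
        map_mul' := fun _ _ => rfl
        map_zero' := rfl
        map_add' := fun _ _ => rfl
        commutes' := fun _ => rfl
        map_star' := fun _ => rfl }
    choose p hp using fun i => hι.exists_starAlgHom_cover hcover hρ ((ev i).comp J)
    let P : C →⋆ₐ[ℂ] lp (fun i => H i →L[ℂ] H i) ∞ :=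
      { toFun := fun c => ⟨fun i => p i c, memℓp_infty ⟨‖c‖, by
          rintro _ ⟨i, rfl⟩
          exact NonUnitalStarAlgHom.norm_apply_le (p i) c⟩⟩
        map_one' := by ext i : 2; simp
        map_mul' := fun a b => by ext i : 2; simp
        map_zero' := by ext i : 2; simp
        map_add' := fun a b => by ext i : 2; exact map_add (p i) a b
        commutes' := fun c => by ext i : 2; simp [Algebra.algebraMap_eq_smul_one]
        map_star' := fun a => by ext i : 2; simp [map_star] }
    have hPρ : ∀ t, P (ρ t) = J (ι t) := fun t => lp.ext (funext fun i => hp i t)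
    -- An injective *-homomorphism is isometric, so its range is closed. As `P` sends the generators
    -- of `C` into it, all of `P` lands there.
    have hclosed : IsClosed (J.range : Set (lp (fun i => H i →L[ℂ] H i) ∞)) :=
      (NonUnitalStarAlgHom.isometry J hJ).isClosedEmbedding.isClosed_range
    have hmem : ∀ c, P c ∈ J.range := by
      have hle : StarAlgebra.adjoin ℂ (Set.range ρ) ≤ J.range.comap P := by
        refine StarAlgebra.adjoin_le ?_
        rintro _ ⟨t, rfl⟩
        exact ⟨ι t, (hPρ t).symm⟩
      intro c
      have hc : c ∈ (StarAlgebra.adjoin ℂ (Set.range ρ)).topologicalClosure := by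
        rw [hρ.generates]; exact StarSubalgebra.mem_top
      exact closure_minimal hle (hclosed.preimage P.continuous_of_cstarAlgebra) hc
    obtain ⟨Q, hJQ⟩ := J.exists_lift hJ P hmem
    have hQ : ∀ t, Q (ρ t) = ι t := fun t => hJ (by rw [hJQ, hPρ])
    refine ⟨Q, ⟨Q.surjective_of_adjoin hcover.generates ?_, hQ⟩, fun R hR => ?_⟩
    · rintro _ ⟨t, rfl⟩
      exact ⟨ρ t, hQ t⟩
    · exact hρ.hom_ext fun t => (hR.2 t).trans (hQ t).symm

/-- Two C*-envelopes of an operator system are isomorphic. -/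
theorem IsCStarEnvelope.exists_starAlgEquiv {E F : Type u} [CStarAlgebra E] [CStarAlgebra F]
    {ι : T →ₗ[ℂ] E} {j : T →ₗ[ℂ] F} (hι : IsCStarEnvelope ι) (hj : IsCStarEnvelope j) :
    ∃ Φ : F ≃⋆ₐ[ℂ] E, ∀ t, Φ (j t) = ι t := by
  obtain ⟨f, ⟨-, hf⟩, -⟩ := hι.universal F j hj.cover
  obtain ⟨g, ⟨-, hg⟩, -⟩ := hj.universal E ι hι.cover
  exact ⟨StarAlgEquiv.ofStarAlgHom f g (hj.cover.hom_ext fun t => by simp [hf, hg])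
    (hι.cover.hom_ext fun t => by simp [hf, hg]), hf⟩

end Envelope

/-! ### Generation and hyperrigidity in the crossed product. -/

theorem OperatorSubsystem.isCompleteOrderEmbedding_incl {B : Type u} [CStarAlgebra B]
    (T : OperatorSubsystem B) : IsCompleteOrderEmbedding T.incl where
  map_one := rfl
  map_pos_iff _ := Iff.rfl

section CrossedProduct

variable {S : Type u} [AddCommGroup S] [Module ℂ S] [StarAddMonoid S] [StarModule ℂ S] [One S]
  [OperatorSystem S] {G : Type u} [Group G]

/-- A closed *-subalgebra of `E ⋊_β G` that contains `E` and `G` is everything. -/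
theorem CrossedProduct.eq_top_of_mem {E : Type u} [CStarAlgebra E] (β : G →* (E ≃⋆ₐ[ℂ] E))
    (B : StarSubalgebra ℂ (CrossedProduct β)) (hB : IsClosed (B : Set (CrossedProduct β)))
    (hE : ∀ a, ofAlg β a ∈ B) (hG : ∀ g, u β g ∈ B) : B = ⊤ := by
  -- `subalgebra β` is a closure taken in `Ambient β`, so minimality has to be used there; `B` stays
  -- closed because `subalgebra β` is.
  have hemb : IsClosed (B.map (subalgebra β).subtype : Set (Ambient β)) :=
    ((StarSubalgebra.isClosed_topologicalClosure _).isClosedEmbedding_subtypeVal.isClosedMap) _ hB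
  have hle : subalgebra β ≤ B.map (subalgebra β).subtype := by
    refine StarSubalgebra.topologicalClosure_minimal (StarAlgebra.adjoin_le ?_) hemb
    rintro _ (⟨a, rfl⟩ | ⟨g, rfl⟩)
    · exact ⟨_, hE a, rfl⟩
    · exact ⟨_, hG g, rfl⟩
  refine eq_top_iff.2 fun x _ => ?_
  obtain ⟨y, hy, hyx⟩ := hle x.2
  rwa [← Subtype.ext (a1 := y) (a2 := x) hyx]

namespace OperatorDynamicalSystem

variable (D : OperatorDynamicalSystem S G) {C : Type u} [CStarAlgebra C] {ρ : S →ₗ[ℂ] C}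
  {β : G →* (C ≃⋆ₐ[ℂ] C)} (h : D.IsAdmissible ρ β)

theorem mul_u_mem_relFullCrossedProduct (a : S) {g : G} (hg : g ∈ D.gens) :
    CrossedProduct.ofAlg β (ρ a) * CrossedProduct.u β g
      ∈ (D.relFullCrossedProduct h).toSubmodule :=
  Submodule.subset_span ⟨a, g, hg, rfl⟩

theorem ofAlg_mem_relFullCrossedProduct (a : S) :
    CrossedProduct.ofAlg β (ρ a) ∈ (D.relFullCrossedProduct h).toSubmodule := by
  have := D.mul_u_mem_relFullCrossedProduct h a D.one_mem
  rwa [CrossedProduct.u_one, mul_one] at this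

theorem u_mem_relFullCrossedProduct {g : G} (hg : g ∈ D.gens) :
    CrossedProduct.u β g ∈ (D.relFullCrossedProduct h).toSubmodule := by
  have := D.mul_u_mem_relFullCrossedProduct h 1 hg
  rwa [h.cover.embedding.map_one, map_one, one_mul] at this

/-- Since `e` is a generator and `1 ∈ S`, the subsystem contains `ρ(S)` and all `u_g` with `g` a
generator. The first generates the copy of `C`, the second all `u_g`, inverses being adjoints. -/
theorem isCStarCover_relFullCrossedProduct :
    IsCStarCover (D.relFullCrossedProduct h).incl where
  embedding := OperatorSubsystem.isCompleteOrderEmbedding_incl _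
  generates := by
    refine StarAlgebra.topologicalClosure_adjoin_eq_top fun B hBc hB => ?_
    have hT : ∀ x ∈ (D.relFullCrossedProduct h).toSubmodule, x ∈ B := fun x hx => hB ⟨⟨x, hx⟩, rfl⟩
    refine CrossedProduct.eq_top_of_mem β B hBc (fun a => ?_) fun g => ?_
    · have hle : StarAlgebra.adjoin ℂ (Set.range ρ) ≤ B.comap (CrossedProduct.ofAlg β) := by
        refine StarAlgebra.adjoin_le ?_
        rintro _ ⟨s, rfl⟩
        exact hT _ (D.ofAlg_mem_relFullCrossedProduct h s)
      have ha : a ∈ (StarAlgebra.adjoin ℂ (Set.range ρ)).topologicalClosure := by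
        rw [h.cover.generates]; exact StarSubalgebra.mem_top
      exact closure_minimal hle
        (hBc.preimage (CrossedProduct.ofAlg β).continuous_of_cstarAlgebra) ha
    · have hg : g ∈ Subgroup.closure D.gens := by rw [D.closure_gens]; trivial
      induction hg using Subgroup.closure_induction with
      | mem g hg => exact hT _ (D.u_mem_relFullCrossedProduct h hg)
      | one => rw [CrossedProduct.u_one]; exact B.one_mem
      | mul g k _ _ hg hk => rw [CrossedProduct.u_mul]; exact mul_mem hg hk
      | inv g _ hg => rw [← CrossedProduct.star_u]; exact star_mem hg

/-- If `ρ(S)` is hyperrigid in the C*-cover `C`, then the crossed product of `S` relative to `C` is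
hyperrigid in `C ⋊_β G`. -/
theorem isHyperrigid_relFullCrossedProduct (hρ : IsHyperrigid ρ) :
    IsHyperrigid (D.relFullCrossedProduct h).incl := by
  intro H _ _ _ π
  refine ⟨π, fun _ => rfl, fun ψ hψ hag c => ?_⟩
  have hag' : ∀ x ∈ (D.relFullCrossedProduct h).toSubmodule, ψ x = π x := fun x hx => hag ⟨x, hx⟩
  -- `ψ` is already defined on the whole crossed product, so only the Stinespring part of the
  -- dilation is needed.
  obtain ⟨K, _, _, _, σ, V, hσ⟩ := hψ.exists_dilation (ρ := LinearMap.id)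
    ⟨rfl, fun _ => Iff.rfl⟩
  replace hσ : ∀ c, compression σ V c = ψ c := hσ
  -- Hyperrigidity of `S` enters here: it upgrades agreement on `ρ(S)` to agreement on all of `C`.
  have hC : ∀ a x, σ (CrossedProduct.ofAlg β a) (V x) = V (π (CrossedProduct.ofAlg β a) x) := by
    refine apply_isometry_eq_of_compression_eq (τ := σ.comp (CrossedProduct.ofAlg β))
      (π := π.comp (CrossedProduct.ofAlg β)) ?_
    refine hρ.eq_of_isUCP _ (isUCP_compression _ V) fun s => ?_
    exact (hσ _).trans (hag' _ (D.ofAlg_mem_relFullCrossedProduct h s))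
  -- Since `u_g* u_g = 1`, the condition on `X* X` is just `V* V = 1`.
  have hG : ∀ g ∈ D.gens, ∀ x,
      σ (CrossedProduct.u β g) (V x) = V (π (CrossedProduct.u β g) x) := by
    intro g hg
    refine apply_isometry_eq_of_compression V
      ((hσ _).trans (hag' _ (D.u_mem_relFullCrossedProduct h hg))) ?_
    rw [← map_star, ← map_star, ← map_mul, ← map_mul, CrossedProduct.star_u,
      ← CrossedProduct.u_mul, inv_mul_cancel, CrossedProduct.u_one, map_one, map_one]
    exact V.adjoint_comp_self
  have hT : ∀ t ∈ (D.relFullCrossedProduct h).toSubmodule, ∀ x, σ t (V x) = V (π t x) := by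
    intro t ht
    induction ht using Submodule.span_induction with
    | mem t ht =>
      obtain ⟨a, g, hg, rfl⟩ := ht
      intro x
      simp [hG g hg, hC]
    | zero => simp
    | add s t _ _ hs ht => intro x; simp [hs, ht]
    | smul r t _ ht => intro x; simp [ht]
  have hcover := D.isCStarCover_relFullCrossedProduct h
  obtain ⟨π', hπ'⟩ := exists_starAlgHom_eq_compression σ V hcover.generates
    (by rintro _ ⟨t, rfl⟩; exact ⟨star t, rfl⟩)
    (by rintro _ ⟨t, rfl⟩ x; exact ⟨_, hT _ t.2 x⟩)
  have hππ' : π' = π := hcover.hom_ext fun t => by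
    rw [hπ', hσ]
    exact hag t
  rw [← hσ, ← hπ', hππ']

end OperatorDynamicalSystem

end CrossedProduct

theorem mainTheorem4 {S : Type u} [AddCommGroup S] [Module ℂ S] [StarAddMonoid S] [StarModule ℂ S]
    [One S] [OperatorSystem S] {G : Type u} [Group G] (D : OperatorDynamicalSystem S G)
    {E : Type u} [CStarAlgebra E] (ι : S →ₗ[ℂ] E) (hι : IsCStarEnvelope ι)
    (hS : IsHyperrigid ι) :
    IsHyperrigid (D.fullEnvelopingCrossedProduct hι).incl ∧
    IsCStarEnvelope (D.fullEnvelopingCrossedProduct hι).incl ∧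
    ∀ (F : Type u) [CStarAlgebra F]
      (j : (D.fullEnvelopingCrossedProduct hι).Carrier →ₗ[ℂ] F), IsCStarEnvelope j →
      IsHyperrigid j ∧
      ∃ Φ : F ≃⋆ₐ[ℂ] CrossedProduct (D.envelopeAction hι), 
        ∀ x, Φ (j x) = (D.fullEnvelopingCrossedProduct hι).incl x := by
  have hadm := D.isAdmissible_envelopeAction hι
  have hrigid : IsHyperrigid (D.fullEnvelopingCrossedProduct hι).incl :=
    D.isHyperrigid_relFullCrossedProduct hadm hS
  have henv : IsCStarEnvelope (D.fullEnvelopingCrossedProduct hι).incl :=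
    -- The faithful family consists of the covariant representations from which the crossed product
    -- was built.
    hrigid.isCStarEnvelope (D.isCStarCover_relFullCrossedProduct hadm)
      (CrossedProduct.subalgebra (D.envelopeAction hι)).subtype Subtype.val_injective
  refine ⟨hrigid, henv, fun F _ j hj => ?_⟩
  obtain ⟨Φ, hΦ⟩ := henv.exists_starAlgEquiv hj
  exact ⟨hrigid.of_starAlgEquiv Φ hΦ, Φ, hΦ⟩
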